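/- Let $0<q<1$, $1<\alpha<2$, $m>0$, $0<T<\infty$. **Operators and Sobolev spaces.** Let $\mathcal L$ be a positive self-adjoint operator on a separable Hilbert space $H$ possessing an orthonormal basis $(\psi_k)_{k\in I}$ of eigenvectors, $\mathcal L\psi_k=\lambda_k\psi_k$, $\lambda_k\ge 0$, $I$ countable. An $\mathcal L$-distribution is a formal series $c=\sum_k c_k\psi_k$ (a vector $h\in H$ has $c_k=\langle h,\psi_k\rangle$), and $\mathcal L$ and $(I+\mathcal L)^{s}$ act on it by multiplying $c_k$ by $\lambda_k$ and $(1+\lambda_k)^{s}$. For $d\in\mathbb R$, $\mathcal H^d_{\mathcal L}$ is the space of those $c$ with $(I+\mathcal L)^{d/2}c\in H$, with norm $\|c\|_{\mathcal H^d_{\mathcal L}}=\|(I+\mathcal L)^{d/2}c\|_H=\big(\sum_k(1+\lambda_k)^d|c_k|^2\big)^{1/2}$; for $d\ge0$ it is a subspace of $H$. **Quantum calculus.** Let $(a;q)_\infty=\prod_{n\ge0}(1-aq^n)$, $(a;q)_\nu=(a;q)_\infty/(q^\nu a;q)_\infty$, $\Gamma_q(x)=\frac{(q;q)_\infty}{(q^x;q)_\infty}(1-q)^{1-x}$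 for $x>0$, $D_qu(t)=\frac{u(t)-u(qt)}{(1-q)t}$ for $t\neq 0$, $\int_0^t g(s)\,d_qs=(1-q)t\sum_{n\ge0}q^ng(tq^n)$ (absolutely convergent), and $${}^cD_q^\alpha u(t)=\frac1{\Gamma_q(2-\alpha)}\int_0^t t^{1-\alpha}(qs/t;q)_{1-\alpha}\,D_q^2u(s)\,d_qs .$$ For functions with values in $\mathcal H^d_{\mathcal L}$ the convergence is absolute convergence in $\mathcal H^d_{\mathcal L}$, and $D_qu(0)=\rho$ means that $\frac{u(xq^n)-u(0)}{xq^n}\to\rho$ in $\mathcal H^d_{\mathcal L}$ as $n\to\infty$, for every $x\in(0,T]$. **Mittag-Leffler functions.** Let $e_{\alpha,\beta}(z;q)=\sum_{k\ge0}\frac{z^k}{\Gamma_q(\alpha k+\beta)}$, and let its $q$-translate be $$\varepsilon^{y}e_{\alpha,\beta}(ct^\alpha;q)=\sum_{k\ge0}\frac{c^kt^{\alpha k}(y/t;q)_{\alpha k}}{\Gamma_q(\alpha k+\beta)} ;$$ these power series in $z$, respectively in $z=ct^\alpha$ (with $y/t$ fixed), converge for $|z|(1-q)^\alpha<1$, and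 outside this disc the symbols denote their real-analytic continuation to $-\infty<z<(1-q)^{-\alpha}$. **Function spaces.** For functions on $[0,T]$ with values in $\mathcal H^d_{\mathcal L}$, the spaces $L_q^\infty([0,T];\mathcal H^{d}_{\mathcal L})$, $W_q^\alpha([0,T];\mathcal H^d_{\mathcal L})$ and $C_q^1([0,T];\mathcal H^d_{\mathcal L})$ are defined by finiteness of $\sup_{0\le t\le T}\|u(t)\|$, of $\sup_{0\le t\le T}\|u(t)\|+\sup_{0\le t\le T}\|{}^cD_q^\alpha u(t)\|$ (where ${}^cD_q^\alpha u$ is required to exist on $(0,T]$, and its value at $t=0$ is the empty integral $0$), and of $\sup_{0<t\le T}\|u(t)\|+\sup_{0<t\le T}\|D_qu(t)\|$, respectively. **Theorem.** There is a constant $C$, depending only on $q,\alpha,m,T$, such that the following holds for all $H$, $\mathcal L$ as above and all $d\in\mathbb R$. Let $\varphi,\rho\in\mathcal H^{d+2}_{\mathcal L}$ and $f\in C_q^1([0,T];\mathcal H^d_{\mathcal L})$. Then the problem $${}^cD_q^\alpha u(t)+\mathcal Lu(t)+mu(t)=f(t)\quad(0<t\le T),\qquad u(0)=\varphi,\qquad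 D_qu(0)=\rho$$ has a unique generalised solution $u\in L_q^\infty([0,T];\mathcal H^{d+2}_{\mathcal L})\cap W_q^\alpha([0,T];\mathcal H^d_{\mathcal L})$. For $0\le t\le T$ it is given by $$u(t)=\sum_{k\in I}\Big[\varphi_k\,e_{\alpha,1}(-(\lambda_k+m)t^\alpha;q)+t\,\rho_k\,e_{\alpha,2}(-(\lambda_k+m)t^\alpha;q)+\int_0^t t^{\alpha-1}(qs/t;q)_{\alpha-1}\,\varepsilon^{q^\alpha s}e_{\alpha,\alpha}(-(\lambda_k+m)t^\alpha;q)\,f_k(s)\,d_qs\Big]\psi_k,$$ where $\varphi_k,\rho_k,f_k$ are the Fourier coefficients and the Jackson integrals converge absolutely, and for $0\le t\le T$ it satisfies $$\|{}^cD_q^\alpha u(t)\|^2_{\mathcal H^d_{\mathcal L}}+\|u(t)\|^2_{\mathcal H^{d+2}_{\mathcal L}}\le C\Big[\|\varphi\|^2_{\mathcal H^{d+2}_{\mathcal L}}+\|\rho\|^2_{\mathcal H^{d+2}_{\mathcal L}}+\|f\|^2_{C_q^1([0,T];\mathcal H^d_{\mathcal L})}\Big].$$ -/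

import Mathlib

open Filter Topology
open scoped ENNReal NNReal

noncomputable section

/-! ### Quantum calculus -/

/-- The infinite `q`-shifted factorial `(a; q)_∞ = ∏_{n ≥ 0} (1 - a q ^ n)`. -/
def qPochInf (a q : ℝ) : ℝ := ∏' n : ℕ, (1 - a * q ^ n)

/-- The `q`-shifted factorial `(a; q)_ν = (a; q)_∞ / (q ^ ν a; q)_∞` of real order `ν`. -/
def qPoch (a q ν : ℝ) : ℝ := qPochInf a q / qPochInf (q ^ ν * a) q

/-- The `q`-Gamma function `Γ_q(x) = (q; q)_∞ / (q ^ x; q)_∞ * (1 - q) ^ (1 - x)`, `x > 0`. -/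
def qGamma (q x : ℝ) : ℝ := qPochInf q q / qPochInf (q ^ x) q * (1 - q) ^ (1 - x)

/-- The `q`-derivative `D_q u (t) = (u t - u (q t)) / (t (1 - q))` at a point `t ≠ 0`. -/
def qDeriv {E : Type*} [AddCommGroup E] [Module ℝ E] (q : ℝ) (u : ℝ → E) (t : ℝ) : E :=
  (t * (1 - q))⁻¹ • (u t - u (q * t))

/-- The Jackson integral `∫_0^a g(s) d_q s = (1 - q) a ∑_n q ^ n g(a q ^ n)`. -/
def jacksonIntegral {E : Type*} [AddCommGroup E] [Module ℝ E] [TopologicalSpace E]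
    (q a : ℝ) (g : ℝ → E) : E :=
  ((1 - q) * a) • ∑' n : ℕ, q ^ n • g (a * q ^ n)

/-- Absolute convergence of the Jackson integral `∫_0^a g(s) d_q s`. -/
def JacksonIntegrable {E : Type*} [NormedAddCommGroup E] [NormedSpace ℝ E]
    (q a : ℝ) (g : ℝ → E) : Prop :=
  Summable fun n : ℕ => ‖q ^ n • g (a * q ^ n)‖

/-- The kernel `(t - q s)_q ^ (ν) = t ^ ν (q s / t; q)_ν`. -/
def qPowKernel (q ν t s : ℝ) : ℝ := t ^ ν * qPoch (q * s / t) q ν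

/-- The Riemann--Liouville `q`-fractional integral of order `α > 0` with base point `0`:
`(I_q^α g)(t) = Γ_q(α)⁻¹ ∫_0^t (t - q s)_q ^ (α - 1) g(s) d_q s`. -/
def rlIntegral {E : Type*} [AddCommGroup E] [Module ℝ E] [TopologicalSpace E]
    (q α : ℝ) (g : ℝ → E) (t : ℝ) : E :=
  (qGamma q α)⁻¹ • jacksonIntegral q t fun s => qPowKernel q (α - 1) t s • g s

/-- The Caputo fractional `q`-derivative of non-integer order `α > 0` with base point `0`:
`ᶜD_q^α u = I_q^{n - α} D_q^n u` with `n = ⌈α⌉`. -/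
def caputo {E : Type*} [AddCommGroup E] [Module ℝ E] [TopologicalSpace E]
    (q α : ℝ) (u : ℝ → E) (t : ℝ) : E :=
  rlIntegral q (⌈α⌉₊ - α) ((qDeriv q)^[⌈α⌉₊] u) t

/-! ### The `q`-Mittag-Leffler function -/

/-- `g` is the real-analytic continuation to `(-∞, R)` of the sum of the power series
`∑ a k z ^ k`, which is required to converge for `|z| < R`. -/
def IsPowerSeriesContinuation (a : ℕ → ℝ) (R : ℝ) (g : ℝ → ℝ) : Prop :=
  AnalyticOnNhd ℝ g (Set.Iio R) ∧ ∀ z : ℝ, |z| < R → HasSum (fun k => a k * z ^ k) (g z)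

open Classical in
/-- The value at `z < R` of the (unique) real-analytic continuation to `(-∞, R)` of the sum of
the power series `∑ a k z ^ k`; by convention `0` if there is no continuation. -/
def powerSeriesContinuation (a : ℕ → ℝ) (R z : ℝ) : ℝ :=
  if h : ∃ g, IsPowerSeriesContinuation a R g then h.choose z else 0

/-- The continuation is unique, so `powerSeriesContinuation` does not depend on any choice. -/
theorem powerSeriesContinuation_eq {a : ℕ → ℝ} {R z : ℝ} {g : ℝ → ℝ}
    (hg : IsPowerSeriesContinuation a R g) (hR : 0 < R) (hz : z < R) :
    powerSeriesContinuation a R z = g z := by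
  have h : ∃ g, IsPowerSeriesContinuation a R g := ⟨g, hg⟩
  have hc := h.choose_spec
  rw [powerSeriesContinuation, dif_pos h]
  refine hc.1.eqOn_of_preconnected_of_eventuallyEq hg.1 isPreconnected_Iio
    (z₀ := 0) hR ?_ hz
  filter_upwards [Metric.ball_mem_nhds (0 : ℝ) hR] with w hw
  have hw' : |w| < R := by simpa using hw
  exact (hc.2 w hw').unique (hg.2 w hw')

/-- The `q`-Mittag-Leffler function `e_{α,β}(z; q) = ∑_k z ^ k / Γ_q(α k + β)` for
`|z (1 - q) ^ α| < 1`, continued real-analytically to all `z < (1 - q) ^ (-α)`. -/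
def qMittagLeffler (q α β z : ℝ) : ℝ :=
  powerSeriesContinuation (fun k => (qGamma q (α * k + β))⁻¹) ((1 - q) ^ (-α)) z

/-- The `q`-translate by `y` of `t ↦ e_{α,β}(c t ^ α; q)`, i.e.
`∑_k c ^ k t ^ (α k) (y / t; q)_{α k} / Γ_q(α k + β)`, the sum of this power series in
`z = c t ^ α` being continued real-analytically to all `z < (1 - q) ^ (-α)`. -/
def qMittagLefflerTranslate (q α β y c t : ℝ) : ℝ :=
  powerSeriesContinuation (fun k => qPoch (y / t) q (α * k) * (qGamma q (α * k + β))⁻¹)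
    ((1 - q) ^ (-α)) (c * t ^ α)

/-! ### Positive operators with discrete spectrum and their Sobolev scale -/

/-- A positive self-adjoint operator on a Hilbert space `H`, together with an orthonormal basis
of eigenvectors `ψ_k` and the corresponding eigenvalues `λ_k ≥ 0`. -/
structure PositiveOperator (𝕜 H I : Type*) [RCLike 𝕜] [NormedAddCommGroup H]
    [InnerProductSpace 𝕜 H] [CompleteSpace H] where
  /-- the (in general unbounded) operator -/
  op : H →ₗ.[𝕜] H
  isSelfAdjoint : IsSelfAdjoint op
  /-- the eigenbasis -/
  basis : HilbertBasis I 𝕜 H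
  /-- the eigenvalues -/
  eigenvalue : I → ℝ
  eigenvalue_nonneg : ∀ k, 0 ≤ eigenvalue k
  basis_mem : ∀ k, basis k ∈ op.domain
  op_basis : ∀ k, op ⟨basis k, basis_mem k⟩ = (eigenvalue k : 𝕜) • basis k

namespace PositiveOperator

variable {𝕜 H I : Type*} [RCLike 𝕜] [NormedAddCommGroup H] [InnerProductSpace 𝕜 H]
  [CompleteSpace H] (L : PositiveOperator 𝕜 H I)

/-- The Fourier coefficients `⟨h, ψ_k⟩` of a vector. General `𝓛`-distributions are given by
their families of Fourier coefficients `c : I → 𝕜` (formal series `∑ c_k ψ_k`), and `H` is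
embedded among them by this map. -/
def coeff (h : H) (k : I) : 𝕜 := inner 𝕜 (L.basis k) h

/-- The operator on `𝓛`-distributions: `𝓛 (∑ c_k ψ_k) = ∑ λ_k c_k ψ_k`. -/
def act (c : I → 𝕜) (k : I) : 𝕜 := L.eigenvalue k • c k

/-- The operator `(I + 𝓛) ^ s` on `𝓛`-distributions. -/
def onePlusPow (s : ℝ) (c : I → 𝕜) (k : I) : 𝕜 := ((1 + L.eigenvalue k) ^ s) • c k

/-- The norm `(∑_k (1 + λ_k) ^ d |c_k| ^ 2) ^ (1 / 2)` of the Sobolev space `𝓗^d`, with value `∞`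
outside this space. Thus `c ∈ 𝓗^d` means `L.eNorm d c < ∞`. -/
def eNorm (d : ℝ) (c : I → 𝕜) : ℝ≥0∞ :=
  (∑' k, ENNReal.ofReal ((1 + L.eigenvalue k) ^ d) * ‖c k‖ₑ ^ 2) ^ (1 / 2 : ℝ)

/-- The norm of `C_q^n([0, T]; 𝓗^d)`. -/
def eNormC (q : ℝ) (n : ℕ) (d T : ℝ) (u : ℝ → I → 𝕜) : ℝ≥0∞ :=
  ∑ i ∈ Finset.range (n + 1), ⨆ t ∈ Set.Ioc 0 T, L.eNorm d ((qDeriv q)^[i] u t)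

/-- `u ∈ C_q^n([0, T]; 𝓗^d)`. -/
def MemC (q : ℝ) (n : ℕ) (d T : ℝ) (u : ℝ → I → 𝕜) : Prop :=
  (∀ t ∈ Set.Icc 0 T, L.eNorm d (u t) < ∞) ∧ L.eNormC q n d T u < ∞

/-- `u ∈ L_q^∞([0, T]; 𝓗^d)`. -/
def MemLinfty (d T : ℝ) (u : ℝ → I → 𝕜) : Prop :=
  ⨆ t ∈ Set.Icc 0 T, L.eNorm d (u t) < ∞

/-- The Caputo derivative `ᶜD_q^α u (t)` exists for `0 < t ≤ T`: the Jackson integral that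
defines it converges absolutely in `𝓗^d`. -/
def HasCaputo (q α d T : ℝ) (u : ℝ → I → 𝕜) : Prop :=
  ∀ t ∈ Set.Ioc 0 T, ∑' n : ℕ, L.eNorm d
    (q ^ n • qPowKernel q (⌈α⌉₊ - α - 1) t (t * q ^ n) • (qDeriv q)^[⌈α⌉₊] u (t * q ^ n)) < ∞

/-- `u ∈ W_q^α([0, T]; 𝓗^d)`. -/
def MemW (q α d T : ℝ) (u : ℝ → I → 𝕜) : Prop :=
  L.HasCaputo q α d T u ∧
    (⨆ t ∈ Set.Icc 0 T, L.eNorm d (u t)) + (⨆ t ∈ Set.Icc 0 T, L.eNorm d (caputo q α u t)) < ∞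

/-- `D_q u (0) = ρ`: for every `x ∈ (0, T]`, the quotients `(u (x q ^ n) - u 0) / (x q ^ n)` tend
to `ρ` in `𝓗^d` as `n → ∞`. -/
def HasQDerivAtZero (q d T : ℝ) (u : ℝ → I → 𝕜) (ρ : I → 𝕜) : Prop :=
  ∀ x ∈ Set.Ioc 0 T, Tendsto
    (fun n : ℕ => L.eNorm d ((x * q ^ n)⁻¹ • (u (x * q ^ n) - u 0) - ρ)) atTop (𝓝 0)

/-- `u` is a generalised solution, in `L_q^∞([0, T]; 𝓗^{d+2}) ∩ W_q^α([0, T]; 𝓗^d)`, of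
`ᶜD_q^α u + 𝓛 u + m u = f` on `(0, T]`, `u 0 = φ`, `D_q u (0) = ρ`. -/
structure IsGeneralisedSolution (q α m d T : ℝ) (φ ρ : I → 𝕜) (f u : ℝ → I → 𝕜) : Prop where
  memLinfty : L.MemLinfty (d + 2) T u
  memW : L.MemW q α d T u
  equation : ∀ t ∈ Set.Ioc 0 T, caputo q α u t + L.act (u t) + m • u t = f t
  initial : u 0 = φ
  initial_deriv : L.HasQDerivAtZero q d T u ρ

/-- The integrand
`s ↦ t ^ (α - 1) (q s / t; q)_{α - 1} ε^{q ^ α s} e_{α,α}(-(λ_k + m) t ^ α; q) f_k(s)`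
of the Duhamel term of the series solution. -/
def duhamelIntegrand (q α m : ℝ) (f : ℝ → I → 𝕜) (t : ℝ) (k : I) (s : ℝ) : 𝕜 :=
  (qPowKernel q (α - 1) t s *
    qMittagLefflerTranslate q α α (q ^ α * s) (-(L.eigenvalue k + m)) t) • f s k

/-- The `k`-th Fourier coefficient at time `t` of the series solution. -/
def seriesSolution (q α m : ℝ) (φ ρ : I → 𝕜) (f : ℝ → I → 𝕜) (t : ℝ) (k : I) : 𝕜 :=
  qMittagLeffler q α 1 (-(L.eigenvalue k + m) * t ^ α) • φ k
    + (t * qMittagLeffler q α 2 (-(L.eigenvalue k + m) * t ^ α)) • ρ k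
    + jacksonIntegral q t (L.duhamelIntegrand q α m f t k)

/-! Compatibility of the definitions on `𝓛`-distributions with the operator on `H`. -/

theorem coeff_op (x : L.op.domain) : L.coeff (L.op x) = L.act (L.coeff (x : H)) := by
  ext k
  have hs := L.isSelfAdjoint
  have h := LinearPMap.adjoint_isFormalAdjoint hs.dense_domain
  rw [LinearPMap.isSelfAdjoint_def.mp hs] at h
  have h1 := h ⟨L.basis k, L.basis_mem k⟩ x
  rw [L.op_basis, inner_smul_left] at h1
  simp only [coeff, act]
  rw [← h1, RCLike.real_smul_eq_coe_mul]
  simp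

theorem eNorm_zero_coeff (h : H) : L.eNorm 0 (L.coeff h) = ‖h‖ₑ := by
  have h1 : HasSum (fun k => ‖L.coeff h k‖ ^ 2) (‖h‖ ^ 2) := by
    have := L.basis.hasSum_inner_mul_inner h h
    rw [inner_self_eq_norm_sq_to_K] at this
    have h2 := RCLike.hasSum_re 𝕜 this
    convert h2 using 1
    · ext k
      simp only [coeff]
      rw [← inner_conj_symm h (L.basis k), RCLike.conj_mul]
      norm_cast
    · norm_cast
  have h3 : ∑' k, ENNReal.ofReal ((1 + L.eigenvalue k) ^ (0 : ℝ)) * ‖L.coeff h k‖ₑ ^ 2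
      = ‖h‖ₑ ^ 2 := by
    have := ENNReal.ofReal_tsum_of_nonneg (fun k => by positivity) h1.summable
    rw [h1.tsum_eq] at this
    simp only [Real.rpow_zero, ENNReal.ofReal_one, one_mul]
    rw [← ofReal_norm, ← ENNReal.ofReal_pow (norm_nonneg _), this]
    refine tsum_congr fun k => ?_
    rw [← ofReal_norm, ← ENNReal.ofReal_pow (norm_nonneg _)]
  rw [eNorm, h3, ← ENNReal.rpow_natCast, ← ENNReal.rpow_mul]
  norm_num

theorem eNorm_eq_onePlusPow (d : ℝ) (c : I → 𝕜) :
    L.eNorm d c = L.eNorm 0 (L.onePlusPow (d / 2) c) := by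
  rw [eNorm, eNorm]
  congr 1
  refine tsum_congr fun k => ?_
  have hk : 0 < 1 + L.eigenvalue k := by linarith [L.eigenvalue_nonneg k]
  rw [onePlusPow, enorm_smul, mul_pow, Real.rpow_zero, ENNReal.ofReal_one, one_mul,
    ← ofReal_norm ((1 + L.eigenvalue k) ^ (d / 2)), ← ENNReal.ofReal_pow (norm_nonneg _),
    Real.norm_of_nonneg (by positivity), ← Real.rpow_natCast, ← Real.rpow_mul hk.le]
  norm_num

/-- `c ∈ 𝓗^d` if and only if `(I + 𝓛) ^ (d / 2) c ∈ H`. -/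
theorem eNorm_lt_top_iff (d : ℝ) (c : I → 𝕜) :
    L.eNorm d c < ∞ ↔ ∃ h : H, L.coeff h = L.onePlusPow (d / 2) c := by
  rw [eNorm_eq_onePlusPow]
  constructor
  · intro h
    set b := L.onePlusPow (d / 2) c
    have h1 : ∑' k, ‖b k‖ₑ ^ 2 ≠ ∞ := by
      intro h2
      simp [eNorm, h2] at h
    have h2 : Memℓp b 2 := by
      rw [memℓp_gen_iff (by norm_num)]
      have h3 : Summable fun k => (‖b k‖ₑ ^ 2).toReal := ENNReal.summable_toReal h1
      simpa using h3
    refine ⟨L.basis.repr.symm ⟨b, h2⟩, ?_⟩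
    ext k
    rw [coeff, ← HilbertBasis.repr_apply_apply]
    simp
  · rintro ⟨h, hh⟩
    rw [← hh, eNorm_zero_coeff]
    exact enorm_lt_top

end PositiveOperator

end

noncomputable section

/-! ### Finite `q`-shifted factorials -/

/-! Everything happens on the lattices `t q^n`. There the fractional integral of order `a` is
`(1-q)^a t^a ∑ q^j (q^a;q)_j / (q;q)_j g(t q^j)`, a formula (`fracOp`) that makes sense for every
real `a`. Composition convolves the coefficients, and q-Vandermonde turns this into additivity of
orders (`fracOp_fracOp`). Since `D_q` lowers the order by one (`qDeriv_fracOp`) and the initial data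
come out of a summation by parts (`fracOp_two_qDeriv`), the Caputo problem for one Fourier
coefficient, with `μ = λ_k + m`, becomes the Volterra equation `u = φ + tρ + I^α(f - μu)`.

Its Neumann series converges only for small `μ t^α`. Put `r = q^α` and `w = -μ t^α (1-q)^α`. The
series `∑ w^k P(r^k)` of a polynomial `P` continues to `Φ_w(P)`, where `Φ_w` sends `X^n` to `1/(1 -
w r^n)` (`geomFunctional`). As `(q^{α(k+1)};q)_j` is the value of `(rX;q)_j` at `r^k`, summing the
Neumann series replaces `(q^α;q)_j` by `Φ_w((rX;q)_j)`; this is `resolventOp`. Vandermonde is a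
polynomial identity, so it passes through `Φ_w`; with the functional equation `w Φ_w(P(rX)) = Φ_w(P)
- P(1)` it proves the resolvent equation (`resolventOp_eq`). Expanding `1/Γ_q` in the polynomials
`(X;q)_j` at `r^k` continues the Mittag-Leffler functions in the same way, and the stated series
becomes `φ + tρ + R_μ(f - μφ - sμρ)`, where `R_μ` is `resolventOp` (`seriesSolution_eq`).

The gain of two Sobolev orders is a bound for `μ R_μ` uniform in `μ` (`norm_smul_resolventOp_le`):
for `w ≤ 0` all `1/(1 - w r^n)` are at most 1, so `Φ_w((X;q)_j)` is bounded in `w` and `j`, and the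
functional equation absorbs the factor `w`. Cauchy–Schwarz over the lattice carries this to the
Sobolev norms.

For uniqueness, the difference of two solutions is bounded and solves the homogeneous Volterra
equation. It vanishes near 0 by contraction and then at every lattice point by backward propagation
(`fracOp_volterra_unique`). -/

/-- The finite `q`-shifted factorial `(a; q)_n = ∏_{i < n} (1 - a q ^ i)`. -/
def qPochFin {R : Type*} [CommRing R] (a q : R) (n : ℕ) : R :=
  ∏ i ∈ Finset.range n, (1 - a * q ^ i)

section CommRing

variable {R : Type*} [CommRing R] (a q : R) (n : ℕ)

@[simp] theorem qPochFin_zero : qPochFin a q 0 = 1 := by simp [qPochFin]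

theorem qPochFin_succ : qPochFin a q (n + 1) = qPochFin a q n * (1 - a * q ^ n) := by
  simp [qPochFin, Finset.prod_range_succ]

theorem qPochFin_succ' : qPochFin a q (n + 1) = (1 - a) * qPochFin (a * q) q n := by
  simp only [qPochFin, Finset.prod_range_succ', pow_zero, mul_one]
  rw [mul_comm]
  congr 1
  exact Finset.prod_congr rfl fun i _ => by ring

theorem qPochFin_shift :
    (1 - a) * qPochFin (a * q) q n = qPochFin a q n * (1 - a * q ^ n) := by
  rw [← qPochFin_succ', qPochFin_succ]

theorem qPochFin_one_left : qPochFin 1 q n = if n = 0 then 1 else 0 := by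
  cases n with
  | zero => simp
  | succ n => simp [qPochFin_succ']

theorem map_qPochFin {S : Type*} [CommRing S] (f : R →+* S) :
    f (qPochFin a q n) = qPochFin (f a) (f q) n := by
  simp [qPochFin, map_prod]

end CommRing

section Real

variable {q : ℝ}

theorem qPochFin_pos {a : ℝ} (hq0 : 0 < q) (hq1 : q < 1) (ha1 : a < 1) (n : ℕ) :
    0 < qPochFin a q n := by
  refine Finset.prod_pos fun i _ => ?_
  have h1 : q ^ i ≤ 1 := pow_le_one₀ hq0.le hq1.le
  have h0 : 0 < q ^ i := by positivity
  nlinarith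

theorem qPochFin_le_one {a : ℝ} (hq0 : 0 < q) (hq1 : q < 1) (ha0 : 0 ≤ a) (ha1 : a < 1) (n : ℕ) :
    qPochFin a q n ≤ 1 := by
  refine Finset.prod_le_one (fun i _ => ?_) fun i _ => ?_
  · have h1 : q ^ i ≤ 1 := pow_le_one₀ hq0.le hq1.le
    have h0 : 0 < q ^ i := by positivity
    nlinarith
  · have : 0 ≤ a * q ^ i := by positivity
    linarith

/-- From `1 + x ≤ exp x` and the geometric series. The bound does not depend on `n`; the uniform
constants for the lattice weights rest on it. -/
theorem prod_one_add_mul_pow_le (hq0 : 0 < q) (hq1 : q < 1) {a : ℝ} (ha : 0 ≤ a) (n : ℕ) :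
    ∏ i ∈ Finset.range n, (1 + a * q ^ i) ≤ Real.exp (a / (1 - q)) := by
  calc ∏ i ∈ Finset.range n, (1 + a * q ^ i)
      ≤ ∏ i ∈ Finset.range n, Real.exp (a * q ^ i) := by
        refine Finset.prod_le_prod (fun i _ => by positivity) fun i _ => ?_
        linarith [Real.add_one_le_exp (a * q ^ i)]
    _ = Real.exp (a * ∑ i ∈ Finset.range n, q ^ i) := by
        rw [← Real.exp_sum, Finset.mul_sum]
    _ ≤ _ := by
        rw [Real.exp_le_exp, div_eq_mul_inv, ← tsum_geometric_of_lt_one hq0.le hq1]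
        gcongr
        exact (summable_geometric_of_lt_one hq0.le hq1).sum_le_tsum _ fun i _ => by positivity

theorem abs_qPochFin_le (hq0 : 0 < q) (hq1 : q < 1) (a : ℝ) (n : ℕ) :
    |qPochFin a q n| ≤ Real.exp (|a| / (1 - q)) := by
  refine le_trans ?_ (prod_one_add_mul_pow_le hq0 hq1 (abs_nonneg a) n)
  rw [qPochFin, Finset.abs_prod]
  refine Finset.prod_le_prod (fun i _ => abs_nonneg _) fun i _ => ?_
  refine (abs_sub _ _).trans ?_
  rw [abs_one, abs_mul, abs_of_pos (pow_pos hq0 i)]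

/-- The `q`-Vandermonde identity. -/
theorem qVandermonde (hq0 : 0 < q) (hq1 : q < 1) (A B : ℝ) (n : ℕ) :
    ∑ p ∈ Finset.HasAntidiagonal.antidiagonal n,
      qPochFin A q p.1 / qPochFin q q p.1 * B ^ p.1 * (qPochFin B q p.2 / qPochFin q q p.2)
      = qPochFin (A * B) q n / qPochFin q q n := by
  have hc : ∀ i, qPochFin q q i ≠ 0 := fun i => (qPochFin_pos hq0 hq1 hq1 i).ne'
  have h1 : ∀ i : ℕ, 1 - q ^ (i + 1) ≠ 0 := fun i => by
    have := pow_lt_one₀ hq0.le hq1 (Nat.succ_ne_zero i)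
    exact (sub_pos.2 this).ne'
  have hs : ∀ a i, qPochFin a q (i + 1) / qPochFin q q (i + 1) * (1 - q ^ (i + 1))
      = qPochFin a q i / qPochFin q q i * (1 - a * q ^ i) := fun a i => by
    have := hc i
    have := h1 i
    have e : 1 - q * q ^ i = 1 - q ^ (i + 1) := by ring
    rw [qPochFin_succ, qPochFin_succ, e]
    field_simp
  induction n with
  | zero => simp
  | succ n ih =>
    -- Write `1 - q^(n+1)` as `(1 - q^p.2) + q^p.2 (1 - q^p.1)`: each bracket lowers one index by
    -- one, and the two resulting sums over level `n` combine to the factor `1 - A B q^n`.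
    have key : (∑ p ∈ Finset.HasAntidiagonal.antidiagonal (n + 1),
      qPochFin A q p.1 / qPochFin q q p.1 * B ^ p.1 * (qPochFin B q p.2 / qPochFin q q p.2))
        * (1 - q ^ (n + 1)) = (∑ p ∈ Finset.HasAntidiagonal.antidiagonal n,
      qPochFin A q p.1 / qPochFin q q p.1 * B ^ p.1 * (qPochFin B q p.2 / qPochFin q q p.2))
        * (1 - A * B * q ^ n) := by
      have split : (∑ p ∈ Finset.HasAntidiagonal.antidiagonal (n + 1),
          qPochFin A q p.1 / qPochFin q q p.1 * B ^ p.1 *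
            (qPochFin B q p.2 / qPochFin q q p.2)) * (1 - q ^ (n + 1))
          = (∑ p ∈ Finset.HasAntidiagonal.antidiagonal (n + 1),
          qPochFin A q p.1 / qPochFin q q p.1 * B ^ p.1 *
            (qPochFin B q p.2 / qPochFin q q p.2 * (1 - q ^ p.2))) +
            ∑ p ∈ Finset.HasAntidiagonal.antidiagonal (n + 1),
          (qPochFin A q p.1 / qPochFin q q p.1 * (1 - q ^ p.1)) * B ^ p.1 *
            (qPochFin B q p.2 / qPochFin q q p.2) * q ^ p.2 := by
        rw [Finset.sum_mul, ← Finset.sum_add_distrib]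
        refine Finset.sum_congr rfl fun p hp => ?_
        rw [← Finset.HasAntidiagonal.mem_antidiagonal.1 hp, pow_add]
        ring
      rw [split, Finset.Nat.sum_antidiagonal_succ', Finset.Nat.sum_antidiagonal_succ]
      simp only [pow_zero, sub_self, mul_zero, zero_mul, zero_add, hs]
      rw [← Finset.sum_add_distrib, Finset.sum_mul]
      refine Finset.sum_congr rfl fun p hp => ?_
      rw [← Finset.HasAntidiagonal.mem_antidiagonal.1 hp, pow_add]
      ring
    rw [ih] at key
    have := hs (A * B) n
    exact mul_right_cancel₀ (h1 n) (key.trans this.symm)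

/-- This is the case `B = q` of q-Vandermonde, where the second quotient is 1. -/
theorem sum_pow_mul_qPochFin_div (hq0 : 0 < q) (hq1 : q < 1) (a : ℝ) (n : ℕ) :
    ∑ j ∈ Finset.range (n + 1), q ^ j * (qPochFin a q j / qPochFin q q j)
      = qPochFin (a * q) q n / qPochFin q q n := by
  have hc : ∀ i, qPochFin q q i ≠ 0 := fun i => (qPochFin_pos hq0 hq1 hq1 i).ne'
  induction n with
  | zero => simp
  | succ n ih =>
    rw [Finset.sum_range_succ, ih, qPochFin_succ' a, qPochFin_succ (a * q), qPochFin_succ q]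
    have := hc n
    have h2 : 1 - q * q ^ n ≠ 0 := by
      have := hc (n + 1)
      rw [qPochFin_succ] at this
      exact right_ne_zero_of_mul this
    field_simp
    ring

/-- The term with `q ^ (n + 1)` closes the induction and disappears in the limit. -/
theorem sum_pow_two_mul_qPochFin_div (hq0 : 0 < q) (hq1 : q < 1) (a : ℝ) (n : ℕ) :
    ∑ j ∈ Finset.range (n + 1), (q ^ 2) ^ j * (qPochFin a q j / qPochFin q q j)
      = (1 - q) * (qPochFin (a * q * q) q n / qPochFin q q n)
        + q ^ (n + 1) * (qPochFin (a * q) q n / qPochFin q q n) := by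
  have hc : ∀ i, qPochFin q q i ≠ 0 := fun i => (qPochFin_pos hq0 hq1 hq1 i).ne'
  induction n with
  | zero => simp
  | succ n ih =>
    rw [Finset.sum_range_succ, ih, qPochFin_succ' a, qPochFin_succ (a * q * q),
      qPochFin_succ (a * q), qPochFin_succ q]
    have := hc n
    have h2 : 1 - q * q ^ n ≠ 0 := by
      have := hc (n + 1)
      rw [qPochFin_succ] at this
      exact right_ne_zero_of_mul this
    have h3 := qPochFin_shift (a * q) q n
    generalize qPochFin (a * q * q) q n = X at h3 ⊢
    generalize qPochFin (a * q) q n = Y at h3 ⊢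
    field_simp
    linear_combination (-(1 - q) * q ^ (n + 1)) * h3

/-! ### Infinite `q`-shifted factorials -/

theorem summable_mul_pow (hq0 : 0 < q) (hq1 : q < 1) (a : ℝ) : Summable fun n : ℕ => a * q ^ n :=
  (summable_geometric_of_lt_one hq0.le hq1).mul_left a

theorem multipliable_qPochInf (hq0 : 0 < q) (hq1 : q < 1) (a : ℝ) :
    Multipliable fun n : ℕ => 1 - a * q ^ n := by
  have := Real.multipliable_one_add_of_summable (summable_mul_pow hq0 hq1 (-a))
  simpa [sub_eq_add_neg] using this

theorem tendsto_qPochFin (hq0 : 0 < q) (hq1 : q < 1) (a : ℝ) :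
    Tendsto (qPochFin a q) atTop (𝓝 (qPochInf a q)) :=
  (multipliable_qPochInf hq0 hq1 a).hasProd.tendsto_prod_nat

theorem qPochInf_pos (hq0 : 0 < q) (hq1 : q < 1) {a : ℝ} (ha1 : a < 1) :
    0 < qPochInf a q := by
  refine lt_of_le_of_ne
    (ge_of_tendsto' (tendsto_qPochFin hq0 hq1 a) fun n => (qPochFin_pos hq0 hq1 ha1 n).le) ?_
  have h := tprod_one_add_ne_zero_of_summable (f := fun n : ℕ => -(a * q ^ n)) (fun n => ?_) ?_
  · simpa [qPochInf, sub_eq_add_neg] using h.symm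
  · have h1 : q ^ n ≤ 1 := pow_le_one₀ hq0.le hq1.le
    have h0 : 0 < q ^ n := by positivity
    nlinarith
  · exact (summable_mul_pow hq0 hq1 a).neg.norm

theorem qPochFin_mul_qPochInf (hq0 : 0 < q) (hq1 : q < 1) (a : ℝ) (n : ℕ) :
    qPochFin a q n * qPochInf (a * q ^ n) q = qPochInf a q := by
  have h := ((multipliable_qPochInf hq0 hq1 (a * q ^ n)).congr fun i => by
    rw [mul_assoc, ← pow_add, add_comm n i] : Multipliable fun i : ℕ => 1 - a * q ^ (i + n))
  have := Multipliable.prod_mul_tprod_nat_mul' (f := fun i : ℕ => 1 - a * q ^ i) (k := n) h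
  rw [qPochInf, qPochInf, qPochFin, ← this]
  congr 1
  refine tprod_congr fun i => ?_
  rw [mul_assoc, ← pow_add, add_comm n i]

theorem qPochInf_le_qPochFin (hq0 : 0 < q) (hq1 : q < 1) {a : ℝ} (ha0 : 0 ≤ a) (ha1 : a < 1)
    (n : ℕ) : qPochInf a q ≤ qPochFin a q n := by
  have hp : 0 ≤ a * q ^ n := by positivity
  have h1 : a * q ^ n < 1 := by
    have h1 : q ^ n ≤ 1 := pow_le_one₀ hq0.le hq1.le
    have h0 : 0 < q ^ n := by positivity
    nlinarith
  rw [← qPochFin_mul_qPochInf hq0 hq1 a n]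
  refine mul_le_of_le_one_right (qPochFin_pos hq0 hq1 ha1 n).le ?_
  exact le_of_tendsto' (tendsto_qPochFin hq0 hq1 _) fun k => qPochFin_le_one hq0 hq1 hp h1 k

theorem abs_qPochFin_div_le (hq0 : 0 < q) (hq1 : q < 1) (a : ℝ) (n : ℕ) :
    |qPochFin a q n / qPochFin q q n| ≤ Real.exp (|a| / (1 - q)) / qPochInf q q := by
  have h := qPochInf_pos hq0 hq1 hq1
  rw [abs_div, abs_of_pos (qPochFin_pos hq0 hq1 hq1 n)]
  exact div_le_div₀ (Real.exp_pos _).le (abs_qPochFin_le hq0 hq1 a n) h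
    (qPochInf_le_qPochFin hq0 hq1 hq0.le hq1 n)

theorem summable_pow_mul_qPochFin_div (hq0 : 0 < q) (hq1 : q < 1) {x : ℝ} (hx0 : 0 ≤ x)
    (hx1 : x < 1) (a : ℝ) :
    Summable fun j : ℕ => x ^ j * (qPochFin a q j / qPochFin q q j) := by
  refine Summable.of_norm_bounded
    ((summable_geometric_of_lt_one hx0 hx1).mul_right (Real.exp (|a| / (1 - q)) / qPochInf q q))
    fun j => ?_
  rw [norm_mul, Real.norm_of_nonneg (by positivity)]
  gcongr
  exact abs_qPochFin_div_le hq0 hq1 a j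

/-- At `a = r^k`, `r = q^α`, the sum is `1/Γ_q(αk+1)` up to a power of `1-q`. So the Mittag-Leffler
coefficients become series of polynomials in `r^k`, to which the rational continuation applies term
by term. -/
theorem hasSum_pow_mul_qPochFin_div (hq0 : 0 < q) (hq1 : q < 1) (a : ℝ) :
    HasSum (fun j : ℕ => q ^ j * (qPochFin a q j / qPochFin q q j))
      (qPochInf (a * q) q / qPochInf q q) := by
  refine (summable_pow_mul_qPochFin_div hq0 hq1 hq0.le hq1 a).hasSum_iff_tendsto_nat.2 ?_
  rw [← tendsto_add_atTop_iff_nat 1]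
  simp_rw [sum_pow_mul_qPochFin_div hq0 hq1]
  exact (tendsto_qPochFin hq0 hq1 _).div (tendsto_qPochFin hq0 hq1 _)
    (qPochInf_pos hq0 hq1 hq1).ne'

theorem hasSum_pow_two_mul_qPochFin_div (hq0 : 0 < q) (hq1 : q < 1) (a : ℝ) :
    HasSum (fun j : ℕ => (q ^ 2) ^ j * (qPochFin a q j / qPochFin q q j))
      ((1 - q) * (qPochInf (a * q * q) q / qPochInf q q)) := by
  refine (summable_pow_mul_qPochFin_div hq0 hq1 (by positivity)
    (pow_lt_one₀ hq0.le hq1 two_ne_zero) a).hasSum_iff_tendsto_nat.2 ?_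
  rw [← tendsto_add_atTop_iff_nat 1]
  simp_rw [sum_pow_two_mul_qPochFin_div hq0 hq1]
  have hne := (qPochInf_pos hq0 hq1 hq1).ne'
  have hd : ∀ b, Tendsto (fun n => qPochFin b q n / qPochFin q q n) atTop
      (𝓝 (qPochInf b q / qPochInf q q)) := fun b =>
    (tendsto_qPochFin hq0 hq1 b).div (tendsto_qPochFin hq0 hq1 q) hne
  have hp := (tendsto_pow_atTop_nhds_zero_of_lt_one hq0.le hq1).comp (tendsto_add_atTop_nat 1)
  have := ((hd (a * q * q)).const_mul (1 - q)).add (hp.mul (hd (a * q)))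
  simpa using this

end Real

/-! ### Rational continuation of `∑ w ^ k P(r ^ k)` -/

section Resolvent

open Polynomial

/-- The linear functional `X ^ n ↦ (1 - w r ^ n)⁻¹` on polynomials. For `|w| < 1` it maps `P` to
`∑ w ^ k P(r ^ k)`. -/
def geomFunctional {F : Type*} [Field F] (r w : F) : F[X] →ₗ[F] F :=
  Polynomial.lsum fun n => (1 - w * r ^ n)⁻¹ • LinearMap.id

/-- The polynomial `(a X; q)_n`. -/
def qPochPoly {F : Type*} [Field F] (a q : F) (n : ℕ) : F[X] := qPochFin (C a * X) (C q) n

section Field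

variable {F : Type*} [Field F] (r w a q : F)

theorem geomFunctional_monomial (n : ℕ) (c : F) :
    geomFunctional r w (monomial n c) = c * (1 - w * r ^ n)⁻¹ := by
  simp [geomFunctional, Polynomial.lsum_apply, Polynomial.sum_monomial_index, mul_comm]

/-- Because `w r^(n+i) = (w r^i) r^n`. As `w` is proportional to `t^α`, this is the passage from `t`
to the lattice point `t q^i`. -/
theorem geomFunctional_X_pow_mul (i : ℕ) (P : F[X]) :
    geomFunctional r w (X ^ i * P) = geomFunctional r (w * r ^ i) P := by
  induction P using Polynomial.induction_on' with
  | add P Q hP hQ => rw [mul_add, map_add, map_add, hP, hQ]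
  | monomial n c =>
    rw [X_pow_mul_monomial, geomFunctional_monomial, geomFunctional_monomial]
    congr 3
    ring

/-- For `|w| < 1` this splits off the term `k = 0` of `∑ w^k P(r^k)`. Both the resolvent equation
and the bound uniform in `μ` come from it. -/
theorem mul_geomFunctional_comp (hw : ∀ n : ℕ, 1 - w * r ^ n ≠ 0) (P : F[X]) :
    w * geomFunctional r w (P.comp (C r * X)) = geomFunctional r w P - P.eval 1 := by
  induction P using Polynomial.induction_on' with
  | add P Q hP hQ => rw [add_comp, map_add, map_add, mul_add, hP, hQ, eval_add]; ring
  | monomial n c =>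
    have h : (monomial n c).comp (C r * X) = monomial n (c * r ^ n) := by
      rw [monomial_comp, mul_pow, ← C_pow, ← mul_assoc, ← C_mul, C_mul_X_pow_eq_monomial]
    rw [h, geomFunctional_monomial, geomFunctional_monomial, eval_monomial]
    have := hw n
    field_simp
    ring

theorem qPochPoly_eval (x : F) (n : ℕ) : (qPochPoly a q n).eval x = qPochFin (a * x) q n := by
  have := map_qPochFin (C a * X) (C q) n (Polynomial.evalRingHom x)
  simpa [qPochPoly] using this

theorem qPochPoly_comp (n : ℕ) : (qPochPoly a q n).comp (C r * X) = qPochPoly (a * r) q n := by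
  have := map_qPochFin (C a * X) (C q) n (Polynomial.compRingHom (C r * X))
  simpa [qPochPoly, mul_assoc] using this

theorem geomFunctional_qPochPoly_succ (n : ℕ) :
    geomFunctional r w (qPochPoly a q (n + 1)) = geomFunctional r w (qPochPoly a q n)
      - a * q ^ n * geomFunctional r (w * r) (qPochPoly a q n) := by
  have h : qPochPoly a q (n + 1)
      = qPochPoly a q n - (a * q ^ n) • (X ^ 1 * qPochPoly a q n) := by
    rw [qPochPoly, qPochFin_succ, ← qPochPoly, smul_eq_C_mul, C_mul, C_pow]
    ring
  rw [h, map_sub, map_smul, geomFunctional_X_pow_mul, smul_eq_mul, pow_one]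

theorem geomFunctional_qPochPoly_zero : geomFunctional r w (qPochPoly a q 0) = (1 - w)⁻¹ := by
  have := geomFunctional_monomial r w 0 1
  simpa [qPochPoly] using this

theorem mul_geomFunctional_qPochPoly (hw : ∀ n : ℕ, 1 - w * r ^ n ≠ 0) (n : ℕ) :
    w * geomFunctional r w (qPochPoly (a * r) q n)
      = geomFunctional r w (qPochPoly a q n) - qPochFin a q n := by
  rw [← qPochPoly_comp, mul_geomFunctional_comp r w hw, qPochPoly_eval, mul_one]

end Field

/-- Peeling off the last factor of `(aX;q)_n` leaves the functional at `w` and at `w r`, so the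
induction needs `M` to work along the whole orbit `w r^i`. Bounding the coefficients of the
polynomial is never necessary. -/
theorem norm_geomFunctional_qPochPoly_le {F : Type*} [NormedField F] (r a q : F) {M : ℝ}
    (n : ℕ) (w : F) (hM : ∀ i : ℕ, ‖(1 - w * r ^ i)⁻¹‖ ≤ M) :
    ‖geomFunctional r w (qPochPoly a q n)‖
      ≤ M * ∏ i ∈ Finset.range n, (1 + ‖a‖ * ‖q‖ ^ i) := by
  induction n generalizing w with
  | zero => simpa [geomFunctional_qPochPoly_zero] using hM 0
  | succ n ih =>
    rw [geomFunctional_qPochPoly_succ, Finset.prod_range_succ]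
    have h1 := ih w hM
    have h2 := ih (w * r) fun i => by
      have := hM (i + 1)
      rwa [pow_succ', ← mul_assoc] at this
    calc _ ≤ ‖geomFunctional r w (qPochPoly a q n)‖
        + ‖a * q ^ n * geomFunctional r (w * r) (qPochPoly a q n)‖ := norm_sub_le _ _
      _ ≤ M * ∏ i ∈ Finset.range n, (1 + ‖a‖ * ‖q‖ ^ i) + ‖a‖ * ‖q‖ ^ n *
          (M * ∏ i ∈ Finset.range n, (1 + ‖a‖ * ‖q‖ ^ i)) := by
        rw [norm_mul, norm_mul, norm_pow]
        gcongr
      _ = _ := by ring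

theorem hasSum_geomFunctional {r w : ℝ} (hr0 : 0 ≤ r) (hr1 : r ≤ 1) (hw : |w| < 1) (P : ℝ[X]) :
    HasSum (fun k : ℕ => w ^ k * P.eval (r ^ k)) (geomFunctional r w P) := by
  induction P using Polynomial.induction_on' with
  | add P Q hP hQ =>
    simpa only [eval_add, mul_add, map_add] using hP.add hQ
  | monomial n c =>
    rw [geomFunctional_monomial]
    have h : ‖w * r ^ n‖ < 1 := by
      rw [norm_mul, Real.norm_of_nonneg (by positivity : 0 ≤ r ^ n)]
      exact lt_of_le_of_lt (mul_le_of_le_one_right (norm_nonneg _) (pow_le_one₀ hr0 hr1)) hw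
    convert! (hasSum_geometric_of_norm_lt_one h).mul_left c using 2 with k
    rw [eval_monomial, mul_pow, ← pow_mul, ← pow_mul, mul_comm k n]
    ring

theorem geomFunctional_qPochPoly_ofReal (r w a q : ℝ) (n : ℕ) :
    geomFunctional (r : ℂ) w (qPochPoly (a : ℂ) q n)
      = (geomFunctional r w (qPochPoly a q n) : ℝ) := by
  induction n generalizing w with
  | zero => simp [geomFunctional_qPochPoly_zero]
  | succ n ih =>
    rw [geomFunctional_qPochPoly_succ, geomFunctional_qPochPoly_succ, ih]
    have := ih (w * r)
    push_cast at this ⊢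
    rw [this]

theorem differentiableAt_geomFunctional {r w : ℂ} (hw : ∀ n : ℕ, 1 - w * r ^ n ≠ 0) (P : ℂ[X]) :
    DifferentiableAt ℂ (fun w => geomFunctional r w P) w := by
  induction P using Polynomial.induction_on' with
  | add P Q hP hQ => simp only [map_add]; exact hP.fun_add hQ
  | monomial n c =>
    simp only [geomFunctional_monomial]
    have := hw n
    fun_prop (disch := assumption)

theorem analyticAt_geomFunctional {r w : ℝ} (hw : ∀ n : ℕ, 1 - w * r ^ n ≠ 0) (P : ℝ[X]) :
    AnalyticAt ℝ (fun w => geomFunctional r w P) w := by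
  induction P using Polynomial.induction_on' with
  | add P Q hP hQ => simp only [map_add]; exact hP.fun_add hQ
  | monomial n c =>
    simp only [geomFunctional_monomial]
    have := hw n
    fun_prop (disch := assumption)

theorem one_sub_mul_pow_pos {r w : ℝ} (hr0 : 0 ≤ r) (hr1 : r ≤ 1) (hw : w < 1) (n : ℕ) :
    0 < 1 - w * r ^ n := by
  have h1 : r ^ n ≤ 1 := pow_le_one₀ hr0 hr1
  have h0 : 0 ≤ r ^ n := by positivity
  rcases le_total w 0 with h | h <;> nlinarith

/-- For `w ≤ 0` each `1 - w r^i` is at least 1, so `M = 1` is admissible and the bound is free of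
`w`. -/
theorem abs_geomFunctional_qPochPoly_le {r w q : ℝ} (hr0 : 0 ≤ r) (hw : w ≤ 0)
    (hq0 : 0 < q) (hq1 : q < 1) (a : ℝ) (n : ℕ) :
    |geomFunctional r w (qPochPoly a q n)| ≤ Real.exp (|a| / (1 - q)) := by
  have h := norm_geomFunctional_qPochPoly_le r a q (M := 1) n w fun i => by
    have h0 : 0 ≤ r ^ i := by positivity
    have : 1 ≤ 1 - w * r ^ i := by nlinarith
    rw [norm_inv, Real.norm_of_nonneg (by linarith)]
    exact inv_le_one_of_one_le₀ this
  rw [one_mul, Real.norm_eq_abs, Real.norm_eq_abs, Real.norm_of_nonneg hq0.le] at h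
  exact h.trans (prod_one_add_mul_pow_le hq0 hq1 (abs_nonneg a) n)

/-- The functional version of the `q`-Vandermonde identity. -/
theorem geomFunctional_qVandermonde {r q : ℝ} (hq0 : 0 < q) (hq1 : q < 1) (w A B : ℝ) (n : ℕ) :
    ∑ p ∈ Finset.HasAntidiagonal.antidiagonal n,
      qPochFin A q p.1 / qPochFin q q p.1 * B ^ p.1 *
        (geomFunctional r (w * r ^ p.1) (qPochPoly B q p.2) / qPochFin q q p.2)
      = geomFunctional r w (qPochPoly (A * B) q n) / qPochFin q q n := by
  -- With `B` replaced by `B X`, q-Vandermonde holds at every real point, hence as an identity of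
  -- polynomials; a linear functional may then be applied to it.
  have h : ∑ p ∈ Finset.HasAntidiagonal.antidiagonal n,
      (qPochFin A q p.1 / qPochFin q q p.1 * B ^ p.1 / qPochFin q q p.2) •
        (X ^ p.1 * qPochPoly B q p.2) = (qPochFin q q n)⁻¹ • qPochPoly (A * B) q n := by
    refine Polynomial.funext fun x => ?_
    rw [eval_finsetSum, eval_smul, qPochPoly_eval, smul_eq_mul, mul_assoc A, inv_mul_eq_div,
      ← qVandermonde hq0 hq1]
    refine Finset.sum_congr rfl fun p _ => ?_
    rw [eval_smul, eval_mul, eval_pow, eval_X, qPochPoly_eval, smul_eq_mul]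
    ring
  have h2 := congrArg (geomFunctional r w) h
  rw [map_sum, map_smul, smul_eq_mul, inv_mul_eq_div] at h2
  rw [← h2]
  refine Finset.sum_congr rfl fun p _ => ?_
  rw [map_smul, geomFunctional_X_pow_mul, smul_eq_mul]
  ring

end Resolvent

/-! ### The `q`-Mittag-Leffler functions on the half-line -/

/-- The continuation `∑_j x ^ j Φ_w((a X; q)_j) / (q; q)_j` of the power series with coefficients
`∑_j x ^ j (a r ^ k; q)_j / (q; q)_j`. -/
def geomSeries (q r x a w : ℝ) : ℝ :=
  ∑' j : ℕ, x ^ j * (geomFunctional r w (qPochPoly a q j) / qPochFin q q j)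

/-- Uniform limits of real-analytic functions need not be analytic, so the series is complexified:
on a half-plane `Re z < c < 1` its terms are holomorphic and dominated by a geometric series.
Choosing `c > 0` makes `Re (1 - z r^n) ≥ 1 - c` hold also where `Re z ≤ 0`. -/
theorem analyticAt_geomSeries {q r x : ℝ} (hq0 : 0 < q) (hq1 : q < 1) (hr0 : 0 ≤ r) (hr1 : r ≤ 1)
    (hx0 : 0 ≤ x) (hx1 : x < 1) (a : ℝ) {w : ℝ} (hw : w < 1) :
    AnalyticAt ℝ (geomSeries q r x a) w := by
  obtain ⟨c, hc, hc1⟩ := exists_between (max_lt hw one_pos)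
  obtain ⟨hwc, hc0⟩ := max_lt_iff.1 hc
  set U : Set ℂ := {z | z.re < c}
  have hU : IsOpen U := isOpen_lt Complex.continuous_re continuous_const
  have hre : ∀ z ∈ U, ∀ n : ℕ, 1 - c ≤ (1 - z * (r : ℂ) ^ n).re := by
    intro z hz n
    have h1 : r ^ n ≤ 1 := pow_le_one₀ hr0 hr1
    have h0 : 0 ≤ r ^ n := by positivity
    have hz' : z.re < c := hz
    rw [← Complex.ofReal_pow, Complex.sub_re, Complex.re_mul_ofReal, Complex.one_re]
    rcases le_total z.re 0 with h | h <;> nlinarith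
  have hnorm : ∀ z ∈ U, ∀ n : ℕ, ‖(1 - z * (r : ℂ) ^ n)⁻¹‖ ≤ (1 - c)⁻¹ := by
    intro z hz n
    rw [norm_inv]
    exact inv_anti₀ (by linarith) ((hre z hz n).trans (Complex.re_le_norm _))
  have hne : ∀ z ∈ U, ∀ n : ℕ, 1 - z * (r : ℂ) ^ n ≠ 0 := by
    intro z hz n h
    have := hre z hz n
    rw [h, Complex.zero_re] at this
    linarith
  set f : ℕ → ℂ → ℂ := fun j z =>
    (x : ℂ) ^ j * (geomFunctional (r : ℂ) z (qPochPoly (a : ℂ) q j) / (qPochFin q q j : ℝ))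
  have hκ := qPochInf_pos hq0 hq1 hq1
  have hbound : ∀ j, ∀ z ∈ U, ‖f j z‖
      ≤ x ^ j * ((1 - c)⁻¹ * Real.exp (|a| / (1 - q)) / qPochInf q q) := by
    intro j z hz
    have h1 := norm_geomFunctional_qPochPoly_le (r : ℂ) (a : ℂ) (q : ℂ) j z (hnorm z hz)
    have h2 := prod_one_add_mul_pow_le hq0 hq1 (abs_nonneg a) j
    rw [Complex.norm_real, Complex.norm_real, Real.norm_eq_abs, Real.norm_of_nonneg hq0.le] at h1
    have hj := qPochFin_pos hq0 hq1 hq1 j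
    have hc' : 0 < 1 - c := by linarith
    simp only [f]
    rw [norm_mul, norm_pow, Complex.norm_real, Real.norm_of_nonneg hx0, norm_div,
      Complex.norm_real, Real.norm_of_nonneg hj.le]
    refine mul_le_mul_of_nonneg_left ?_ (by positivity)
    refine div_le_div₀ (by positivity) (h1.trans ?_) hκ (qPochInf_le_qPochFin hq0 hq1 hq0.le hq1 j)
    gcongr
  have hdiff : DifferentiableOn ℂ (fun z => ∑' j, f j z) U := by
    refine Complex.differentiableOn_tsum_of_summable_norm
      ((summable_geometric_of_lt_one hx0 hx1).mul_right _) (fun j z hz => ?_) hU hbound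
    exact (((differentiableAt_geomFunctional (hne z hz) _).div_const _).const_mul
      _).differentiableWithinAt
  have han : AnalyticAt ℂ (fun z => ∑' j, f j z) (w : ℂ) :=
    hdiff.analyticAt (hU.mem_nhds (by simpa [U] using hwc))
  have hreal := han.re_ofReal
  refine hreal.congr (Eventually.of_forall fun s => ?_)
  simp only [f, geomFunctional_qPochPoly_ofReal]
  rw [geomSeries, ← Complex.ofReal_re (∑' j : ℕ, _)]
  push_cast
  rfl

/-- Fubini for the sums over `j` and `k`, which converge absolutely since `|w| < 1` and `x < 1`. -/
theorem hasSum_geomSeries {q r x : ℝ} (hq0 : 0 < q) (hq1 : q < 1) (hr0 : 0 ≤ r) (hr1 : r ≤ 1)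
    (hx0 : 0 ≤ x) (hx1 : x < 1) (a : ℝ) {w : ℝ} (hw : |w| < 1) {S : ℕ → ℝ}
    (hS : ∀ k, HasSum (fun j : ℕ => x ^ j * (qPochFin (a * r ^ k) q j / qPochFin q q j)) (S k)) :
    HasSum (fun k => S k * w ^ k) (geomSeries q r x a w) := by
  set G : ℕ × ℕ → ℝ := fun p =>
    w ^ p.2 * (x ^ p.1 * (qPochFin (a * r ^ p.2) q p.1 / qPochFin q q p.1))
  have hκ := qPochInf_pos hq0 hq1 hq1
  have hsum : Summable G := by
    refine Summable.of_norm_bounded (g := fun p : ℕ × ℕ =>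
      x ^ p.1 * |w| ^ p.2 * (Real.exp (|a| / (1 - q)) / qPochInf q q)) ?_ fun p => ?_
    · exact ((summable_geometric_of_lt_one hx0 hx1).mul_of_nonneg
        (summable_geometric_of_lt_one (abs_nonneg w) hw) (fun _ => by positivity)
        (fun _ => by positivity)).mul_right _
    · have h1 := abs_qPochFin_div_le hq0 hq1 (a * r ^ p.2) p.1
      simp only [G]
      rw [norm_mul, norm_mul, norm_pow, norm_pow, Real.norm_eq_abs w, Real.norm_of_nonneg hx0,
        mul_left_comm, ← mul_assoc]
      refine mul_le_mul_of_nonneg_left (h1.trans ?_) (by positivity)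
      have h2 : |a * r ^ p.2| ≤ |a| := by
        rw [abs_mul, abs_of_nonneg (by positivity : 0 ≤ r ^ p.2)]
        exact mul_le_of_le_one_right (abs_nonneg _) (pow_le_one₀ hr0 hr1)
      have : 0 < 1 - q := by linarith
      gcongr
  have h1 : ∀ j, HasSum (fun k => G (j, k))
      (x ^ j * (geomFunctional r w (qPochPoly a q j) / qPochFin q q j)) := by
    intro j
    have := ((hasSum_geomFunctional hr0 hr1 hw (qPochPoly a q j)).div_const
      (qPochFin q q j)).mul_left (x ^ j)
    convert! this using 2 with k
    simp only [G, qPochPoly_eval]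
    ring
  have h2 := hsum.hasSum.prod_fiberwise h1
  have h3 : HasSum (fun k => S k * w ^ k) (∑' p, G p) := by
    have := (hsum.prod_symm.hasSum).prod_fiberwise (g := fun k => S k * w ^ k) fun k => by
      convert! (hS k).mul_left (w ^ k) using 1
      ring
    rwa [show ∑' p : ℕ × ℕ, G p.swap = ∑' p, G p from (Equiv.prodComm ℕ ℕ).tsum_eq G] at this
  rw [geomSeries, h2.tsum_eq]
  exact h3

section

variable {q α : ℝ}

theorem rpow_one_sub_mul_cancel (hq1 : q < 1) : (1 - q) ^ (-α) * (1 - q) ^ α = 1 := by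
  rw [← Real.rpow_add (by linarith), neg_add_cancel, Real.rpow_zero]

theorem isPowerSeriesContinuation_scale (hq1 : q < 1) {a b : ℕ → ℝ} {F : ℝ → ℝ}
    (hF : ∀ w < 1, AnalyticAt ℝ F w) (hs : ∀ w, |w| < 1 → HasSum (fun k => b k * w ^ k) (F w))
    (hab : ∀ k : ℕ, a k = b k * ((1 - q) ^ α) ^ k) :
    IsPowerSeriesContinuation a ((1 - q) ^ (-α)) fun z => F (z * (1 - q) ^ α) := by
  have hpos : 0 < (1 - q) ^ α := Real.rpow_pos_of_pos (by linarith) _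
  refine ⟨fun z hz => ?_, fun z hz => ?_⟩
  · refine AnalyticAt.fun_comp (g := F) (f := fun z => z * (1 - q) ^ α) (hF _ ?_) (by fun_prop)
    exact (mul_lt_mul_of_pos_right hz hpos).trans_eq (rpow_one_sub_mul_cancel hq1)
  · have : |z * (1 - q) ^ α| < 1 := by
      rw [abs_mul, abs_of_pos hpos]
      exact (mul_lt_mul_of_pos_right hz hpos).trans_eq (rpow_one_sub_mul_cancel hq1)
    convert! hs _ this using 2 with k
    rw [hab, mul_pow]
    ring

theorem powerSeriesContinuation_scale (hq1 : q < 1) {a b : ℕ → ℝ} {F : ℝ → ℝ}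
    (hF : ∀ w < 1, AnalyticAt ℝ F w) (hs : ∀ w, |w| < 1 → HasSum (fun k => b k * w ^ k) (F w))
    (hab : ∀ k : ℕ, a k = b k * ((1 - q) ^ α) ^ k) {z : ℝ} (hz : z ≤ 0) :
    powerSeriesContinuation a ((1 - q) ^ (-α)) z = F (z * (1 - q) ^ α) := by
  have hpos : 0 < (1 - q) ^ (-α) := Real.rpow_pos_of_pos (by linarith) _
  exact powerSeriesContinuation_eq (isPowerSeriesContinuation_scale hq1 hF hs hab) hpos
    (hz.trans_lt hpos)

theorem inv_qGamma (hq1 : q < 1) (x : ℝ) :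
    (qGamma q x)⁻¹ = qPochInf (q ^ x) q / qPochInf q q * (1 - q) ^ (x - 1) := by
  rw [qGamma, mul_inv, inv_div, ← Real.rpow_neg (by linarith), neg_sub]

theorem qMittagLeffler_one (hq0 : 0 < q) (hq1 : q < 1) (hα : 0 < α) {z : ℝ} (hz : z ≤ 0) :
    qMittagLeffler q α 1 z = geomSeries q (q ^ α) q 1 (z * (1 - q) ^ α) := by
  have hr0 : 0 ≤ q ^ α := by positivity
  have hr1 : q ^ α ≤ 1 := Real.rpow_le_one hq0.le hq1.le hα.le
  refine powerSeriesContinuation_scale hq1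
    (b := fun k => qPochInf (1 * (q ^ α) ^ k * q) q / qPochInf q q)
    (fun w hw => analyticAt_geomSeries hq0 hq1 hr0 hr1 hq0.le hq1 1 hw)
    (fun w hw => hasSum_geomSeries hq0 hq1 hr0 hr1 hq0.le hq1 1 hw
      fun k => hasSum_pow_mul_qPochFin_div hq0 hq1 _) (fun k => ?_) hz
  rw [inv_qGamma hq1, one_mul, Real.rpow_add hq0, Real.rpow_one, Real.rpow_mul_natCast hq0.le,
    add_sub_cancel_right, Real.rpow_mul_natCast (by linarith)]

theorem qMittagLeffler_two (hq0 : 0 < q) (hq1 : q < 1) (hα : 0 < α) {z : ℝ} (hz : z ≤ 0) :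
    qMittagLeffler q α 2 z = geomSeries q (q ^ α) (q ^ 2) 1 (z * (1 - q) ^ α) := by
  have hr0 : 0 ≤ q ^ α := by positivity
  have hr1 : q ^ α ≤ 1 := Real.rpow_le_one hq0.le hq1.le hα.le
  have h20 : 0 ≤ q ^ 2 := by positivity
  have h21 : q ^ 2 < 1 := pow_lt_one₀ hq0.le hq1 two_ne_zero
  refine powerSeriesContinuation_scale hq1
    (b := fun k => (1 - q) * (qPochInf (1 * (q ^ α) ^ k * q * q) q / qPochInf q q))
    (fun w hw => analyticAt_geomSeries hq0 hq1 hr0 hr1 h20 h21 1 hw)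
    (fun w hw => hasSum_geomSeries hq0 hq1 hr0 hr1 h20 h21 1 hw
      fun k => hasSum_pow_two_mul_qPochFin_div hq0 hq1 _) (fun k => ?_) hz
  have h1 : α * k + 2 - 1 = α * k + 1 := by ring
  rw [inv_qGamma hq1, one_mul, Real.rpow_add hq0, Real.rpow_mul_natCast hq0.le, h1,
    Real.rpow_add (by linarith), Real.rpow_mul_natCast (by linarith), Real.rpow_one,
    Real.rpow_two, pow_two q, mul_assoc _ q q]
  ring

theorem mul_pow_lt_one (hq0 : 0 < q) (hq1 : q < 1) {a : ℝ} (ha : a < 1) (n : ℕ) :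
    a * q ^ n < 1 := by
  have h1 : q ^ n ≤ 1 := pow_le_one₀ hq0.le hq1.le
  have h0 : 0 < q ^ n := by positivity
  nlinarith

/-- At lattice points the infinite products in `(y/t;q)_{αk} / Γ_q(αk+α)` collapse to `(r r^k;q)_j`,
up to the scaling `(1-q)^{αk}` and a factor independent of `k`. The coefficients are thus polynomial
in `r^k`, and the continuation is a rational function. -/
theorem qMittagLefflerTranslate_lattice (hq0 : 0 < q) (hq1 : q < 1) (hα : 0 < α) {c t : ℝ}
    (hc : c ≤ 0) (ht : 0 < t) (j : ℕ) :
    qMittagLefflerTranslate q α α (q ^ α * (t * q ^ j)) c t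
      = qPochInf (q ^ α * q ^ j) q / qPochInf q q * (1 - q) ^ (α - 1) *
        geomFunctional (q ^ α) (c * t ^ α * (1 - q) ^ α) (qPochPoly (q ^ α) q j) := by
  have hr0 : 0 ≤ q ^ α := by positivity
  have hr1 : q ^ α < 1 := Real.rpow_lt_one hq0.le hq1 hα
  have hz : c * t ^ α ≤ 0 := mul_nonpos_of_nonpos_of_nonneg hc (by positivity)
  set K := qPochInf (q ^ α * q ^ j) q / qPochInf q q * (1 - q) ^ (α - 1)
  refine powerSeriesContinuation_scale (F := fun w => K * geomFunctional (q ^ α) w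
    (qPochPoly (q ^ α) q j)) hq1
    (b := fun k => K * qPochFin (q ^ α * (q ^ α) ^ k) q j) (fun w hw => ?_) (fun w hw => ?_)
    (fun k => ?_) hz
  · exact analyticAt_const.mul
      (analyticAt_geomFunctional (fun n => (one_sub_mul_pow_pos hr0 hr1.le hw n).ne') _)
  · convert! (hasSum_geomFunctional hr0 hr1.le hw (qPochPoly (q ^ α) q j)).mul_left K using 2
      with k
    rw [qPochPoly_eval]
    ring
  · have h1 : α * k + α - 1 = α * k + (α - 1) := by ring
    have h2 : q ^ α * (t * q ^ j) / t = q ^ α * q ^ j := by field_simp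
    have hk : q ^ α * (q ^ α) ^ k < 1 := by
      rw [← pow_succ']
      exact pow_lt_one₀ hr0 hr1 k.succ_ne_zero
    have h3 := qPochFin_mul_qPochInf hq0 hq1 (q ^ α * (q ^ α) ^ k) j
    have h4 := (qPochInf_pos hq0 hq1 (mul_pow_lt_one hq0 hq1 hk j)).ne'
    rw [inv_qGamma hq1, h1, h2, Real.rpow_add (by linarith : 0 < 1 - q),
      Real.rpow_mul_natCast (by linarith : 0 ≤ 1 - q), qPoch, Real.rpow_add hq0,
      Real.rpow_mul_natCast hq0.le, mul_comm ((q ^ α) ^ k) (q ^ α), ← h3,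
      show (q ^ α) ^ k * (q ^ α * q ^ j) = q ^ α * (q ^ α) ^ k * q ^ j by ring]
    simp only [K]
    set X := qPochInf (q ^ α * (q ^ α) ^ k * q ^ j) q
    clear_value X
    field_simp

theorem qPowKernel_lattice (hq0 : 0 < q) (ν : ℝ) {t : ℝ} (ht : 0 < t) (j : ℕ) :
    qPowKernel q ν t (t * q ^ j)
      = t ^ ν * (qPochInf (q * q ^ j) q / qPochInf (q ^ (ν + 1) * q ^ j) q) := by
  have h : q * (t * q ^ j) / t = q * q ^ j := by field_simp
  rw [qPowKernel, qPoch, h, Real.rpow_add hq0, Real.rpow_one, mul_assoc]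

theorem qPowKernel_mul_translate (hq0 : 0 < q) (hq1 : q < 1) (hα : 0 < α) {c t : ℝ}
    (hc : c ≤ 0) (ht : 0 < t) (j : ℕ) :
    qPowKernel q (α - 1) t (t * q ^ j) *
      qMittagLefflerTranslate q α α (q ^ α * (t * q ^ j)) c t
      = t ^ (α - 1) * (1 - q) ^ (α - 1) *
        (geomFunctional (q ^ α) (c * t ^ α * (1 - q) ^ α) (qPochPoly (q ^ α) q j) /
          qPochFin q q j) := by
  have hr1 : q ^ α < 1 := Real.rpow_lt_one hq0.le hq1 hα
  have h1 := (qPochInf_pos hq0 hq1 (mul_pow_lt_one hq0 hq1 hr1 j)).ne'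
  have h2 := (qPochInf_pos hq0 hq1 (mul_pow_lt_one hq0 hq1 hq1 j)).ne'
  have h3 := (qPochFin_pos hq0 hq1 hq1 j).ne'
  rw [qPowKernel_lattice hq0 _ ht, qMittagLefflerTranslate_lattice hq0 hq1 hα hc ht,
    ← qPochFin_mul_qPochInf hq0 hq1 q j, sub_add_cancel]
  set X := qPochInf (q ^ α * q ^ j) q
  clear_value X
  field_simp

end

/-! ### Fractional `q`-integrals and `q`-derivatives of arbitrary real order -/

section FracOp

variable {E : Type*} [NormedAddCommGroup E] [NormedSpace ℝ E]

/-- The `q`-fractional integral of order `a` (derivative of order `-a` if `a < 0`), as a series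
over the lattice `t q ^ j`. -/
def fracOp (q a : ℝ) (g : ℝ → E) (t : ℝ) : E :=
  ((1 - q) ^ a * t ^ a) •
    ∑' j : ℕ, (q ^ j * (qPochFin (q ^ a) q j / qPochFin q q j)) • g (t * q ^ j)

/-- The solution operator `g ↦ v` of the Volterra equation `v = I^α (g - μ v)`. -/
def resolventOp (q α μ : ℝ) (g : ℝ → E) (t : ℝ) : E :=
  ((1 - q) ^ α * t ^ α) • ∑' j : ℕ, (q ^ j * (geomFunctional (q ^ α) (-μ * t ^ α * (1 - q) ^ α)
    (qPochPoly (q ^ α) q j) / qPochFin q q j)) • g (t * q ^ j)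

variable {q : ℝ}

theorem fracOp_congr {a t : ℝ} {g h : ℝ → E} (hgh : ∀ j : ℕ, g (t * q ^ j) = h (t * q ^ j)) :
    fracOp q a g t = fracOp q a h t := by
  simp only [fracOp, hgh]

theorem mul_pow_rpow (hq0 : 0 < q) {t : ℝ} (ht : 0 < t) (b : ℝ) (i : ℕ) :
    (t * q ^ i) ^ b = t ^ b * (q ^ b) ^ i := by
  rw [Real.mul_rpow ht.le (by positivity), Real.rpow_pow_comm hq0.le]

/-- Composition of two lattice operators, regrouped along `i + j = n`. The inner weights may depend
on `i`, as they do for the resolvent. -/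
theorem tsum_smul_tsum_antidiagonal [CompleteSpace E] (a : ℕ → ℝ) (b : ℕ → ℕ → ℝ) (c : ℕ → ℝ)
    (g : ℕ → E) (hs : Summable fun p : ℕ × ℕ => (a p.1 * b p.1 p.2) • g (p.1 + p.2))
    (hc : ∀ n, ∑ p ∈ Finset.HasAntidiagonal.antidiagonal n, a p.1 * b p.1 p.2 = c n) :
    ∑' i, a i • ∑' j, b i j • g (i + j) = ∑' n, c n • g n := by
  have h1 : ∑' i, a i • ∑' j, b i j • g (i + j)
      = ∑' p : ℕ × ℕ, (a p.1 * b p.1 p.2) • g (p.1 + p.2) := by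
    rw [hs.tsum_prod]
    refine tsum_congr fun i => ?_
    rw [← tsum_const_smul'']
    simp only [smul_smul]
  have hs' := Finset.HasAntidiagonal.sigmaAntidiagonalEquivProd.summable_iff.2 hs
  have h2 := hs'.tsum_sigma
  rw [h1, ← Finset.HasAntidiagonal.sigmaAntidiagonalEquivProd.tsum_eq (_ : ℕ × ℕ → E)]
  refine h2.trans ?_
  refine tsum_congr fun n => ?_
  rw [← hc n, Finset.sum_smul, tsum_fintype]
  refine Eq.trans ?_ (Finset.sum_coe_sort (Finset.HasAntidiagonal.antidiagonal n)
    fun p => (a p.1 * b p.1 p.2) • g n)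
  refine Finset.sum_congr rfl fun p _ => ?_
  have hp := Finset.HasAntidiagonal.mem_antidiagonal.1 p.2
  simp only [Function.comp_apply, Finset.HasAntidiagonal.sigmaAntidiagonalEquivProd_apply]
  rw [hp]

/-- For bounded `g` the weight `q^i` is still to spare, so `x = q^b` may exceed 1; this admits
orders `b > -1`. -/
theorem summable_geom_mul_bounded {E : Type*} [NormedAddCommGroup E] (hq0 : 0 < q) (hq1 : q < 1) {x M : ℝ} (hx0 : 0 ≤ x)
    (hx1 : x * q < 1) {g : ℕ → E} (hg : ∀ n, ‖g n‖ ≤ M) :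
    Summable fun p : ℕ × ℕ => x ^ p.1 * q ^ (p.1 + p.2) * ‖g (p.1 + p.2)‖ := by
  refine Summable.of_nonneg_of_le (fun p => by positivity) (fun p => ?_)
    (((summable_geometric_of_lt_one (by positivity) hx1).mul_of_nonneg
      (summable_geometric_of_lt_one hq0.le hq1) (fun _ => by positivity)
      (fun _ => by positivity)).mul_right M)
  rw [pow_add, ← mul_assoc, mul_pow]
  exact mul_le_mul_of_nonneg_left (hg _) (by positivity)

/-- Here `g` is only summable against `q^n`, so decay in the first index must come from `x < 1`,
that is, from a positive order. -/
theorem summable_geom_mul_summable {E : Type*} [NormedAddCommGroup E] (hq0 : 0 < q) {x : ℝ} (hx0 : 0 ≤ x)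
    (hx1 : x < 1) {g : ℕ → E} (hg : Summable fun n => q ^ n * ‖g n‖) :
    Summable fun p : ℕ × ℕ => x ^ p.1 * q ^ (p.1 + p.2) * ‖g (p.1 + p.2)‖ := by
  have h0 : ∀ n, 0 ≤ q ^ n * ‖g n‖ := fun n => by positivity
  have hi : ∀ i, Summable fun j => q ^ (i + j) * ‖g (i + j)‖ := fun i =>
    hg.comp_injective (add_right_injective i)
  refine (summable_prod_of_nonneg fun p => ?_).2 ⟨fun i => ?_, ?_⟩
  · exact mul_nonneg (by positivity) (norm_nonneg _)
  · simpa only [mul_assoc] using (hi i).mul_left (x ^ i)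
  · refine Summable.of_nonneg_of_le (fun i => tsum_nonneg fun j => by positivity) (fun i => ?_)
      ((summable_geometric_of_lt_one hx0 hx1).mul_right (∑' n, q ^ n * ‖g n‖))
    simp only [mul_assoc, tsum_mul_left]
    refine mul_le_mul_of_nonneg_left ?_ (by positivity)
    exact (hi i).tsum_le_tsum_of_inj (fun j => i + j) (add_right_injective i) (fun n _ => h0 n)
      (fun j => le_rfl) hg

theorem summable_antidiagonal_of_bounds [CompleteSpace E] (hq0 : 0 < q) {x K₁ K₂ : ℝ}
    (hx0 : 0 ≤ x) {A : ℕ → ℝ} {B : ℕ → ℕ → ℝ} {g : ℕ → E}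
    (hs : Summable fun p : ℕ × ℕ => x ^ p.1 * q ^ (p.1 + p.2) * ‖g (p.1 + p.2)‖)
    (hA : ∀ i, |A i| ≤ K₁) (hB : ∀ i j, |B i j| ≤ K₂) :
    Summable fun p : ℕ × ℕ => (q ^ p.1 * A p.1 * x ^ p.1 * (q ^ p.2 * B p.1 p.2)) •
      g (p.1 + p.2) := by
  have hK : 0 ≤ K₁ := (abs_nonneg _).trans (hA 0)
  refine Summable.of_norm_bounded (hs.mul_left (K₁ * K₂)) fun p => ?_
  have e : q ^ p.1 * A p.1 * x ^ p.1 * (q ^ p.2 * B p.1 p.2)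
      = A p.1 * B p.1 p.2 * (x ^ p.1 * q ^ (p.1 + p.2)) := by ring
  rw [norm_smul, e, norm_mul (A p.1 * B p.1 p.2), norm_mul (A p.1), ← mul_assoc (K₁ * K₂),
    Real.norm_of_nonneg (by positivity : 0 ≤ x ^ p.1 * q ^ (p.1 + p.2))]
  refine mul_le_mul_of_nonneg_right (mul_le_mul_of_nonneg_right ?_ (by positivity))
    (norm_nonneg _)
  exact mul_le_mul (hA _) (hB _ _) (abs_nonneg _) hK

/-- Evaluating the inner operator at `t q^i` produces the factor `(q^b)^i`, which is the `B ^ p.1`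
of q-Vandermonde. -/
theorem fracOp_fracOp [CompleteSpace E] (hq0 : 0 < q) (hq1 : q < 1) (a b : ℝ) {t : ℝ}
    (ht : 0 < t) {g : ℝ → E}
    (hs : Summable fun p : ℕ × ℕ =>
      (q ^ b) ^ p.1 * q ^ (p.1 + p.2) * ‖g (t * q ^ (p.1 + p.2))‖) :
    fracOp q a (fracOp q b g) t = fracOp q (a + b) g t := by
  have hx : 0 ≤ q ^ b := by positivity
  have hsum := summable_antidiagonal_of_bounds hq0 hx (g := fun n => g (t * q ^ n))
    (A := fun i => qPochFin (q ^ a) q i / qPochFin q q i)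
    (B := fun _ j => qPochFin (q ^ b) q j / qPochFin q q j) hs
    (fun i => abs_qPochFin_div_le hq0 hq1 (q ^ a) i)
    (fun _ j => abs_qPochFin_div_le hq0 hq1 (q ^ b) j)
  have key := tsum_smul_tsum_antidiagonal
    (fun i => q ^ i * (qPochFin (q ^ a) q i / qPochFin q q i) * (q ^ b) ^ i)
    (fun _ j => q ^ j * (qPochFin (q ^ b) q j / qPochFin q q j))
    (fun n => q ^ n * (qPochFin (q ^ (a + b)) q n / qPochFin q q n))
    (fun n => g (t * q ^ n)) hsum fun n => by
    rw [Real.rpow_add hq0, ← qVandermonde hq0 hq1, Finset.mul_sum]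
    refine Finset.sum_congr rfl fun p hp => ?_
    rw [← Finset.HasAntidiagonal.mem_antidiagonal.1 hp, pow_add]
    ring
  rw [fracOp, fracOp, ← key, Real.rpow_add (by linarith : 0 < 1 - q), Real.rpow_add ht,
    show (1 - q) ^ a * (1 - q) ^ b * (t ^ a * t ^ b)
      = ((1 - q) ^ a * t ^ a) * ((1 - q) ^ b * t ^ b) by ring,
    mul_smul ((1 - q) ^ a * t ^ a)]
  congr 1
  rw [← tsum_const_smul'']
  refine tsum_congr fun i => ?_
  simp only [fracOp, mul_pow_rpow hq0 ht, smul_smul, pow_add, mul_assoc]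
  congr 1
  ring

/-- At `t q^i` the parameter becomes `w r^i`, so the functional q-Vandermonde identity with `A = B =
r` gives the composite the weights `Φ_w((r²X;q)_n)`. Times `w`, these are the resolvent weights
minus those of `I^α`, by the functional equation. -/
theorem resolventOp_eq [CompleteSpace E] (hq0 : 0 < q) (hq1 : q < 1) {α μ t M : ℝ} (hα : 0 < α)
    (hμ : 0 ≤ μ) (ht : 0 < t) {g : ℝ → E} (hg : ∀ n : ℕ, ‖g (t * q ^ n)‖ ≤ M) :
    resolventOp q α μ g t = fracOp q α g t - μ • fracOp q α (resolventOp q α μ g) t := by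
  set r := q ^ α with hr
  set w := -μ * t ^ α * (1 - q) ^ α with hw
  have hr0 : 0 < r := Real.rpow_pos_of_pos hq0 _
  have hr1 : r < 1 := Real.rpow_lt_one hq0.le hq1 hα
  have h1q : 0 < (1 - q) ^ α := Real.rpow_pos_of_pos (by linarith) _
  have hta : 0 < t ^ α := Real.rpow_pos_of_pos ht _
  have hw0 : w ≤ 0 := by
    have : 0 ≤ μ * t ^ α * (1 - q) ^ α := by positivity
    rw [hw]; linarith
  have hκ := qPochInf_pos hq0 hq1 hq1
  have hcoef : ∀ (w' : ℝ) (_ : w' ≤ 0) (j : ℕ),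
      |geomFunctional r w' (qPochPoly r q j) / qPochFin q q j|
        ≤ Real.exp (|r| / (1 - q)) / qPochInf q q := fun w' hw' j => by
    rw [abs_div, abs_of_pos (qPochFin_pos hq0 hq1 hq1 j)]
    exact div_le_div₀ (Real.exp_pos _).le (abs_geomFunctional_qPochPoly_le hr0.le hw' hq0 hq1 r j)
      hκ (qPochInf_le_qPochFin hq0 hq1 hq0.le hq1 j)
  have hsum := summable_antidiagonal_of_bounds hq0 hr0.le (g := fun n => g (t * q ^ n))
    (A := fun i => qPochFin r q i / qPochFin q q i)
    (B := fun i j => geomFunctional r (w * r ^ i) (qPochPoly r q j) / qPochFin q q j)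
    (summable_geom_mul_bounded (g := fun n => g (t * q ^ n)) hq0 hq1 hr0.le (by nlinarith) hg)
    (fun i => abs_qPochFin_div_le hq0 hq1 r i)
    (fun i j => hcoef _ (mul_nonpos_of_nonpos_of_nonneg hw0 (by positivity)) j)
  have key := tsum_smul_tsum_antidiagonal
    (fun i => q ^ i * (qPochFin r q i / qPochFin q q i) * r ^ i)
    (fun i j => q ^ j * (geomFunctional r (w * r ^ i) (qPochPoly r q j) / qPochFin q q j))
    (fun n => q ^ n * (geomFunctional r w (qPochPoly (r * r) q n) / qPochFin q q n))
    (fun n => g (t * q ^ n)) hsum fun n => by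
    rw [← geomFunctional_qVandermonde hq0 hq1, Finset.mul_sum]
    refine Finset.sum_congr rfl fun p hp => ?_
    rw [← Finset.HasAntidiagonal.mem_antidiagonal.1 hp, pow_add]
    ring
  have hsm : ∀ c : ℕ → ℝ, (∃ K, ∀ j, |c j| ≤ K) →
      Summable fun j : ℕ => (q ^ j * c j) • g (t * q ^ j) := by
    rintro c ⟨K, hK⟩
    refine Summable.of_norm_bounded ((summable_geometric_of_lt_one hq0.le hq1).mul_right (K * M))
      fun j => ?_
    rw [norm_smul, norm_mul, Real.norm_of_nonneg (by positivity : 0 ≤ q ^ j), mul_assoc]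
    have := (abs_nonneg _).trans (hK j)
    gcongr
    exacts [hK j, hg j]
  have hcomp : fracOp q α (resolventOp q α μ g) t
      = ((1 - q) ^ α * t ^ α) • ((1 - q) ^ α * t ^ α) •
        ∑' n : ℕ, (q ^ n * (geomFunctional r w (qPochPoly (r * r) q n) / qPochFin q q n)) •
          g (t * q ^ n) := by
    rw [fracOp, ← key]
    congr 1
    rw [← tsum_const_smul'']
    refine tsum_congr fun i => ?_
    have e : -μ * (t ^ α * (q ^ α) ^ i) * (1 - q) ^ α = w * r ^ i := by rw [hw, hr]; ring
    simp only [resolventOp, mul_pow_rpow hq0 ht, e, smul_smul, pow_add, mul_assoc]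
    congr 1
    ring
  have hV : ∀ n, w * geomFunctional r w (qPochPoly (r * r) q n)
      = geomFunctional r w (qPochPoly r q n) - qPochFin r q n := fun n =>
    mul_geomFunctional_qPochPoly r w r q
      (fun n => (one_sub_mul_pow_pos hr0.le hr1.le (by linarith) n).ne') n
  rw [hcomp, smul_comm μ, smul_smul μ, fracOp, resolventOp, ← smul_sub, ← hw, ← hr]
  congr 1
  rw [show μ * ((1 - q) ^ α * t ^ α) = -w by rw [hw]; ring, neg_smul, sub_neg_eq_add,
    ← tsum_const_smul'']
  simp only [smul_smul]
  have hV' : ∀ n : ℕ, w * (q ^ n * (geomFunctional r w (qPochPoly (r * r) q n) / qPochFin q q n))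
      = q ^ n * ((geomFunctional r w (qPochPoly r q n) - qPochFin r q n) / qPochFin q q n) :=
    fun n => by rw [← hV]; ring
  simp only [hV']
  rw [← Summable.tsum_add]
  · refine tsum_congr fun n => ?_
    rw [← add_smul]
    congr 1
    ring
  · exact hsm _ ⟨_, abs_qPochFin_div_le hq0 hq1 r⟩
  · refine hsm _ ⟨Real.exp (|r| / (1 - q)) / qPochInf q q + Real.exp (|r| / (1 - q)) /
      qPochInf q q, fun j => ?_⟩
    rw [sub_div]
    exact (abs_sub _ _).trans (add_le_add (hcoef w hw0 j) (abs_qPochFin_div_le hq0 hq1 r j))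

theorem summable_fracOp [CompleteSpace E] (hq0 : 0 < q) (hq1 : q < 1) (c : ℝ) {g : ℕ → E}
    (hs : Summable fun n => q ^ n * ‖g n‖) :
    Summable fun j : ℕ => (q ^ j * (qPochFin c q j / qPochFin q q j)) • g j := by
  refine Summable.of_norm_bounded (hs.mul_left (Real.exp (|c| / (1 - q)) / qPochInf q q))
    fun j => ?_
  rw [norm_smul, norm_mul, Real.norm_of_nonneg (by positivity : 0 ≤ q ^ j), mul_right_comm,
    mul_comm]
  gcongr
  exact abs_qPochFin_div_le hq0 hq1 c j

theorem summable_of_bounded {E : Type*} [NormedAddCommGroup E] (hq0 : 0 < q) (hq1 : q < 1) {g : ℕ → E} {M : ℝ}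
    (hg : ∀ n, ‖g n‖ ≤ M) : Summable fun n => q ^ n * ‖g n‖ := by
  refine Summable.of_nonneg_of_le (fun n => by positivity) (fun n => ?_)
    ((summable_geometric_of_lt_one hq0.le hq1).mul_right M)
  gcongr
  exact hg n

theorem qDeriv_fracOp [CompleteSpace E] (hq0 : 0 < q) (hq1 : q < 1) (a : ℝ) {t : ℝ} (ht : 0 < t)
    {g : ℝ → E} (hs : Summable fun n : ℕ => q ^ n * ‖g (t * q ^ n)‖) :
    qDeriv q (fracOp q a g) t = fracOp q (a - 1) g t := by
  -- A q-Pascal rule: it matches the weights at `t q^(j+1)` coming from `t` and from `q t`.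
  have hcoef : ∀ j : ℕ, q ^ (j + 1) * (qPochFin (q ^ (a - 1)) q (j + 1) / qPochFin q q (j + 1))
      = q ^ (j + 1) * (qPochFin (q ^ a) q (j + 1) / qPochFin q q (j + 1))
        - q ^ a * (q ^ j * (qPochFin (q ^ a) q j / qPochFin q q j)) := fun j => by
    have h1 := (qPochFin_pos hq0 hq1 hq1 j).ne'
    have h2 : 1 - q * q ^ j ≠ 0 := (sub_pos.2 (mul_pow_lt_one hq0 hq1 hq1 j)).ne'
    have h3 : q ^ a = q ^ (a - 1) * q := by
      rw [← Real.rpow_add_one hq0.ne', sub_add_cancel]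
    rw [h3]
    generalize q ^ (a - 1) = B
    rw [qPochFin_succ' B, qPochFin_succ (B * q), qPochFin_succ q]
    field_simp
    ring
  have hS := summable_fracOp hq0 hq1 (q ^ a) hs
  have hS1 := (summable_nat_add_iff 1).2 hS
  have hS' := summable_fracOp hq0 hq1 (q ^ (a - 1)) hs
  have hq' : ∀ j : ℕ, g (q * t * q ^ j) = g (t * q ^ (j + 1)) := fun j => by
    rw [pow_succ]; congr 1; ring
  have hT : Summable fun j : ℕ => (q ^ j * (qPochFin (q ^ a) q j / qPochFin q q j)) •
      g (t * q ^ (j + 1)) := by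
    refine summable_fracOp hq0 hq1 (q ^ a) (g := fun j => g (t * q ^ (j + 1))) ?_
    refine (((summable_nat_add_iff 1).2 hs).mul_left q⁻¹).congr fun j => ?_
    rw [pow_succ]
    field_simp
  have h1q : 0 < 1 - q := by linarith
  rw [qDeriv, fracOp, fracOp, fracOp, hS.tsum_eq_zero_add, hS'.tsum_eq_zero_add]
  simp only [hq', hcoef]
  rw [Real.mul_rpow hq0.le ht.le,
    show (1 - q) ^ a * (q ^ a * t ^ a) = (1 - q) ^ a * t ^ a * q ^ a by ring, mul_smul _ (q ^ a),
    ← smul_sub, smul_smul, add_sub_assoc, ← tsum_const_smul'', ← Summable.tsum_sub hS1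
      (hT.const_smul _)]
  simp only [smul_smul, ← sub_smul]
  congr 1
  · rw [Real.rpow_sub_one h1q.ne', Real.rpow_sub_one ht.ne']
    field_simp

/-- The order-two weights reduce to `t (1 - q^(n+1))` against differences of `D_q v`, so summation
by parts gives the partial sums in closed form; their limit brings in `v 0` and `ρ`. -/
theorem fracOp_two_qDeriv [CompleteSpace E] (hq0 : 0 < q) (hq1 : q < 1) {t : ℝ} (ht : 0 < t)
    {v : ℝ → E} {ρ : E} (hs : Summable fun n : ℕ => q ^ n * ‖(qDeriv q)^[2] v (t * q ^ n)‖)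
    (hρ : Tendsto (fun n : ℕ => (t * q ^ n)⁻¹ • (v (t * q ^ n) - v 0)) atTop (𝓝 ρ)) :
    fracOp q 2 ((qDeriv q)^[2] v) t = v t - v 0 - t • ρ := by
  set d : ℕ → E := fun n => qDeriv q v (t * q ^ n) with hd
  have h1q : 0 < 1 - q := by linarith
  have hstep : ∀ n : ℕ, q * (t * q ^ n) = t * q ^ (n + 1) := fun n => by ring
  have hdd : ∀ n, (qDeriv q)^[2] v (t * q ^ n) = (t * q ^ n * (1 - q))⁻¹ • (d n - d (n + 1)) :=
    fun n => by
    simp only [hd, ← hstep]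
    rfl
  have hdv : ∀ n, ((1 - q) * q ^ n * t) • d n = v (t * q ^ n) - v (t * q ^ (n + 1)) := fun n => by
    simp only [hd, qDeriv]
    rw [smul_smul, hstep]
    have : (1 - q) * q ^ n * t * (t * q ^ n * (1 - q))⁻¹ = 1 := by field_simp
    rw [this, one_smul]
  have hterm : ∀ n : ℕ, ((1 - q) ^ (2 : ℝ) * t ^ (2 : ℝ)) •
      (q ^ n * (qPochFin (q ^ (2 : ℝ)) q n / qPochFin q q n)) • (qDeriv q)^[2] v (t * q ^ n)
      = (t * (1 - q ^ (n + 1))) • (d n - d (n + 1)) := fun n => by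
    rw [hdd, smul_smul, smul_smul]
    congr 1
    have h1 := (qPochFin_pos hq0 hq1 hq1 n).ne'
    have h2 := qPochFin_shift q q n
    have h3 : qPochFin (q * q) q n / qPochFin q q n = (1 - q * q ^ n) / (1 - q) := by
      rw [div_eq_div_iff h1 h1q.ne', mul_comm, h2]
      ring
    rw [Real.rpow_two, Real.rpow_two, Real.rpow_two, pow_two q, h3]
    field_simp
    ring
  have hpartial : ∀ N : ℕ, ∑ n ∈ Finset.range N, (t * (1 - q ^ (n + 1))) • (d n - d (n + 1))
      = v t - v (t * q ^ N) - (t * (1 - q ^ N)) • d N := fun N => by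
    induction N with
    | zero => simp
    | succ N ih =>
      have h : v (t * q ^ N) = ((1 - q) * q ^ N * t) • d N + v (t * q ^ (N + 1)) := by
        rw [hdv]; abel
      rw [Finset.sum_range_succ, ih, h]
      module
  have hpow := tendsto_pow_atTop_nhds_zero_of_lt_one hq0.le hq1
  have hv : Tendsto (fun n : ℕ => v (t * q ^ n)) atTop (𝓝 (v 0)) := by
    have := ((hpow.const_mul t).smul hρ).add_const (v 0)
    rw [mul_zero, zero_smul, zero_add] at this
    refine this.congr fun n => ?_
    rw [smul_smul, mul_inv_cancel₀ (by positivity), one_smul, sub_add_cancel]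
  -- With `Q_n` the difference quotient from 0 at `t q^n`, one has `D_q v (t q^n) = (Q_n - q
  -- Q_{n+1}) / (1 - q)`.
  have hdρ : Tendsto d atTop (𝓝 ρ) := by
    have := (hρ.sub ((hρ.comp (tendsto_add_atTop_nat 1)).const_smul q)).const_smul (1 - q)⁻¹
    rw [show (1 - q)⁻¹ • (ρ - q • ρ) = ρ by
      rw [show ρ - q • ρ = (1 - q) • ρ by module, smul_smul, inv_mul_cancel₀ h1q.ne',
        one_smul]] at this
    refine this.congr fun n => ?_
    have e : ((1 - q) * q ^ n * t)⁻¹ • (((1 - q) * q ^ n * t) • d n) = d n := by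
      rw [smul_smul, inv_mul_cancel₀ (by positivity), one_smul]
    have e1 : q * (t * q ^ (n + 1))⁻¹ = (t * q ^ n)⁻¹ := by
      rw [pow_succ]
      field_simp
    have e2 : ((1 - q) * q ^ n * t)⁻¹ = (1 - q)⁻¹ * (t * q ^ n)⁻¹ := by
      rw [← mul_inv]
      congr 1
      ring
    rw [← e, hdv, e2]
    simp only [Function.comp_apply]
    rw [smul_smul q, e1, ← smul_sub, smul_smul]
    congr 1
    abel
  have hS := (summable_fracOp hq0 hq1 (q ^ (2 : ℝ)) hs).const_smul
    ((1 - q) ^ (2 : ℝ) * t ^ (2 : ℝ))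
  rw [fracOp, ← tsum_const_smul'']
  simp only [hterm] at hS ⊢
  refine tendsto_nhds_unique hS.hasSum.tendsto_sum_nat ?_
  simp_rw [hpartial]
  have := (hv.const_sub (v t)).sub (((hpow.const_sub 1).const_mul t).smul hdρ)
  simpa using this

theorem norm_fracOp_le (hq0 : 0 < q) (hq1 : q < 1) (a : ℝ) {t : ℝ} (ht : 0 < t) (g : ℝ → E) :
    ‖fracOp q a g t‖ₑ ≤ ENNReal.ofReal ((1 - q) ^ a * (Real.exp (|q ^ a| / (1 - q)) /
      qPochInf q q) * t ^ a) * ∑' j : ℕ, ENNReal.ofReal (q ^ j) * ‖g (t * q ^ j)‖ₑ := by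
  have h1q : 0 < 1 - q := by linarith
  have hκ := qPochInf_pos hq0 hq1 hq1
  rw [fracOp, enorm_smul, Real.enorm_of_nonneg (by positivity),
    mul_right_comm ((1 - q) ^ a) _ (t ^ a),
    ENNReal.ofReal_mul (p := (1 - q) ^ a * t ^ a) (by positivity), mul_assoc (ENNReal.ofReal _),
    ← ENNReal.tsum_mul_left]
  gcongr
  refine (enorm_tsum_le_tsum_enorm).trans (ENNReal.tsum_le_tsum fun j => ?_)
  rw [enorm_smul, ← mul_assoc, ← ENNReal.ofReal_mul (by positivity)]
  gcongr
  rw [Real.enorm_eq_ofReal_abs, abs_mul, abs_of_pos (pow_pos hq0 j), mul_comm]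
  gcongr
  exact abs_qPochFin_div_le hq0 hq1 _ j

theorem norm_smul_resolventOp_le (hq0 : 0 < q) (hq1 : q < 1) {α μ t : ℝ} (hα : 0 < α)
    (hμ : 0 ≤ μ) (ht : 0 < t) (g : ℝ → E) :
    ‖μ • resolventOp q α μ g t‖ₑ ≤ ENNReal.ofReal (2 * Real.exp (1 / (1 - q)) / qPochInf q q) *
      ∑' j : ℕ, ENNReal.ofReal (q ^ j) * ‖g (t * q ^ j)‖ₑ := by
  have h1q : 0 < 1 - q := by linarith
  have hκ := qPochInf_pos hq0 hq1 hq1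
  have hr0 : 0 < q ^ α := Real.rpow_pos_of_pos hq0 _
  have hr1 : q ^ α < 1 := Real.rpow_lt_one hq0.le hq1 hα
  set w := -μ * t ^ α * (1 - q) ^ α with hw
  have hw0 : w ≤ 0 := by
    have : 0 ≤ μ * t ^ α * (1 - q) ^ α := by positivity
    rw [hw]; linarith
  have hcoef : ∀ j : ℕ, |w * (geomFunctional (q ^ α) w (qPochPoly (q ^ α) q j) / qPochFin q q j)|
      ≤ 2 * Real.exp (1 / (1 - q)) / qPochInf q q := fun j => by
    -- The factor `μ` turns into `-w`. The functional equation with `a = 1` replaces `w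
    -- Φ_w((rX;q)_j)` by `Φ_w((X;q)_j) - (1;q)_j`, bounded independently of `w`: no growth in `μ`
    -- remains.
    have h := mul_geomFunctional_qPochPoly (q ^ α) w 1 q
      (fun n => (one_sub_mul_pow_pos hr0.le hr1.le (by linarith) n).ne') j
    rw [one_mul] at h
    rw [← mul_div_assoc, h, abs_div, abs_of_pos (qPochFin_pos hq0 hq1 hq1 j)]
    refine div_le_div₀ (by positivity) ?_ hκ (qPochInf_le_qPochFin hq0 hq1 hq0.le hq1 j)
    have h1 := abs_geomFunctional_qPochPoly_le hr0.le hw0 hq0 hq1 1 j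
    have h2 := abs_qPochFin_le hq0 hq1 1 j
    rw [abs_one] at h1 h2
    refine (abs_sub _ _).trans ?_
    linarith
  have e : μ * ((1 - q) ^ α * t ^ α) = -w := by rw [hw]; ring
  rw [resolventOp, smul_smul, e, neg_smul, enorm_neg, ← tsum_const_smul'', ← hw,
    ← ENNReal.tsum_mul_left]
  refine (enorm_tsum_le_tsum_enorm).trans (ENNReal.tsum_le_tsum fun j => ?_)
  rw [smul_smul, enorm_smul, ← mul_assoc (ENNReal.ofReal _), ← ENNReal.ofReal_mul (by positivity)]
  gcongr
  rw [Real.enorm_eq_ofReal_abs, mul_left_comm, abs_mul, abs_of_pos (pow_pos hq0 j), mul_comm]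
  gcongr
  exact hcoef j

theorem fracOp_volterra_unique (hq0 : 0 < q) (hq1 : q < 1) {α μ T M : ℝ}
    (hα : 0 < α) (hμ : 0 ≤ μ) {d : ℝ → E} (hM : ∀ t ∈ Set.Ioc 0 T, ‖d t‖ ≤ M)
    (hd : ∀ t ∈ Set.Ioc 0 T, d t = -(μ • fracOp q α d t)) {t : ℝ} (ht : t ∈ Set.Ioc 0 T) :
    d t = 0 := by
  have hmem : ∀ n : ℕ, t * q ^ n ∈ Set.Ioc 0 T := fun n =>
    ⟨mul_pos ht.1 (pow_pos hq0 n),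
      (mul_le_of_le_one_right ht.1.le (pow_le_one₀ hq0.le hq1.le)).trans ht.2⟩
  have h1q : 0 < 1 - q := by linarith
  have hκ := qPochInf_pos hq0 hq1 hq1
  have hr0 : 0 < q ^ α := Real.rpow_pos_of_pos hq0 _
  have hr1 : q ^ α < 1 := Real.rpow_lt_one hq0.le hq1 hα
  set K := (1 - q) ^ α * (Real.exp (|q ^ α| / (1 - q)) / qPochInf q q) with hK
  have hK0 : 0 ≤ K := by positivity
  have hbd : ∀ n : ℕ, ∀ B : ℝ, (∀ j : ℕ, ‖d (t * q ^ (n + j))‖ ≤ B) →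
      ‖d (t * q ^ n)‖ ≤ μ * (K * (t ^ α * (q ^ α) ^ n)) * ((1 - q)⁻¹ * B) := by
    intro n B hB
    have hB0 : 0 ≤ B := (norm_nonneg _).trans (hB 0)
    have h := norm_fracOp_le hq0 hq1 α (hmem n).1 d
    have h2 : ∑' j : ℕ, ENNReal.ofReal (q ^ j) * ‖d (t * q ^ n * q ^ j)‖ₑ
        ≤ ENNReal.ofReal ((1 - q)⁻¹ * B) := by
      have hg := (summable_geometric_of_lt_one hq0.le hq1).mul_right B
      rw [← tsum_geometric_of_lt_one hq0.le hq1, ← tsum_mul_right,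
        ENNReal.ofReal_tsum_of_nonneg (fun j => by positivity) hg]
      refine ENNReal.tsum_le_tsum fun j => ?_
      rw [ENNReal.ofReal_mul (by positivity), mul_assoc t, ← pow_add, ← ofReal_norm]
      gcongr
      exact hB j
    rw [mul_pow_rpow hq0 ht.1] at h
    have h3 := h.trans (mul_le_mul_right h2 _)
    rw [← ENNReal.ofReal_mul (by have := Real.rpow_nonneg ht.1.le α; positivity), ← ofReal_norm,
      ENNReal.ofReal_le_ofReal_iff (by have := Real.rpow_nonneg ht.1.le α; positivity)] at h3
    rw [hd _ (hmem n), norm_neg, norm_smul, Real.norm_of_nonneg hμ, mul_assoc]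
    exact mul_le_mul_of_nonneg_left h3 hμ
  -- At `t q^n` the operator `μ I^α` has norm of order `q^(αn)`, so from some `N` on it contracts by
  -- 1/2; iterating on a bounded function forces zero there.
  obtain ⟨N, hN⟩ : ∃ N : ℕ, ∀ n ≥ N, μ * (K * (t ^ α * (q ^ α) ^ n)) * (1 - q)⁻¹ ≤ 1 / 2 := by
    have h := ((((tendsto_pow_atTop_nhds_zero_of_lt_one hr0.le hr1).const_mul (t ^ α)).const_mul
      K).const_mul μ).mul_const (1 - q)⁻¹
    simp only [mul_zero, zero_mul] at h
    exact eventually_atTop.1 (h.eventually_le_const (by norm_num))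
  have hsmall : ∀ p : ℕ, ∀ n ≥ N, ‖d (t * q ^ n)‖ ≤ (1 / 2) ^ p * M := by
    intro p
    induction p with
    | zero => intro n _; simpa using hM _ (hmem n)
    | succ p ih =>
      intro n hn
      refine (hbd n _ fun j => ih (n + j) (by omega)).trans ?_
      have hM0 : 0 ≤ M := (norm_nonneg _).trans (hM _ ht)
      rw [← mul_assoc, pow_succ', mul_assoc (1 / 2 : ℝ)]
      exact mul_le_mul_of_nonneg_right (hN n hn) (by positivity)
  have hzero : ∀ n ≥ N, d (t * q ^ n) = 0 := by
    intro n hn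
    have h : Tendsto (fun p : ℕ => (1 / 2 : ℝ) ^ p * M) atTop (𝓝 (0 * M)) :=
      (tendsto_pow_atTop_nhds_zero_of_lt_one (by norm_num) (by norm_num)).mul_const M
    rw [zero_mul] at h
    exact norm_le_zero_iff.1 (ge_of_tendsto' h fun p => hsmall p n hn)
  have hall : ∀ n ≥ 0, d (t * q ^ n) = 0 := by
    -- If all later lattice values vanish, only the term `j = 0` survives, and the equation reads
    -- `(1 + μ c) d = 0` with `c ≥ 0`.
    refine Nat.decreasingInduction (motive := fun m _ => ∀ n ≥ m, d (t * q ^ n) = 0)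
      (fun m _ ih n hn => ?_) hzero (Nat.zero_le N)
    rcases hn.lt_or_eq with h | rfl
    · exact ih n h
    have h := hd _ (hmem m)
    rw [fracOp, tsum_eq_single 0] at h
    · have hp : 0 < 1 + μ * ((1 - q) ^ α * (t * q ^ m) ^ α) := by
        have := Real.rpow_nonneg (hmem m).1.le α
        positivity
      rw [pow_zero, qPochFin_zero, qPochFin_zero, div_one, mul_one, one_smul, mul_one,
        smul_smul] at h
      have h2 : (1 + μ * ((1 - q) ^ α * (t * q ^ m) ^ α)) • d (t * q ^ m) = 0 := by
        rw [add_smul, one_smul]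
        nth_rewrite 1 [h]
        simp
      exact (smul_eq_zero.1 h2).resolve_left hp.ne'
    · intro j hj
      rw [mul_assoc, ← pow_add, ih _ (by omega), smul_zero]
  simpa using hall 0 le_rfl

end FracOp

/-! ### Estimates in the Sobolev norms -/

namespace ENNReal

theorem mul_le_sq_add_sq (a b : ℝ≥0∞) : a * b ≤ a ^ 2 + b ^ 2 := by
  rcases le_total a b with h | h
  · calc a * b ≤ b * b := by gcongr
      _ = b ^ 2 := (sq b).symm
      _ ≤ _ := le_add_self
  · calc a * b ≤ a * a := by gcongr
      _ = a ^ 2 := (sq a).symm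
      _ ≤ _ := le_self_add

theorem add_sq_le_four_mul (a b : ℝ≥0∞) : (a + b) ^ 2 ≤ 4 * (a ^ 2 + b ^ 2) := by
  rcases le_total a b with h | h
  · calc (a + b) ^ 2 ≤ (b + b) ^ 2 := by gcongr
      _ = 4 * b ^ 2 := by ring
      _ ≤ _ := by gcongr; exact le_add_self
  · calc (a + b) ^ 2 ≤ (a + a) ^ 2 := by gcongr
      _ = 4 * a ^ 2 := by ring
      _ ≤ _ := by gcongr; exact le_self_add

/-- Cauchy–Schwarz with a lossy constant: expand the square as a double sum and use `g_i g_j ≤ g_i²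
+ g_j²`. No finiteness is required. -/
theorem tsum_mul_sq_le {ι : Type*} (a g : ι → ℝ≥0∞) :
    (∑' j, a j * g j) ^ 2 ≤ 4 * (∑' j, a j) * ∑' j, a j * g j ^ 2 := by
  calc (∑' j, a j * g j) ^ 2 = ∑' i, ∑' j, a i * a j * (g i * g j) := by
        rw [sq, ← ENNReal.tsum_mul_right]
        refine tsum_congr fun i => ?_
        rw [← ENNReal.tsum_mul_left]
        exact tsum_congr fun j => by ring
    _ ≤ ∑' i, ∑' j, a i * a j * (g i ^ 2 + g j ^ 2) := by
        gcongr
        exact mul_le_sq_add_sq _ _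
    _ = 2 * (∑' j, a j) * ∑' j, a j * g j ^ 2 := by
        have h1 : ∑' i, ∑' j, a i * a j * (g i ^ 2 + g j ^ 2)
            = ∑' i, ((a i * g i ^ 2) * (∑' j, a j) + a i * ∑' j, a j * g j ^ 2) := by
          refine tsum_congr fun i => ?_
          rw [← ENNReal.tsum_mul_left, ← ENNReal.tsum_mul_left, ← ENNReal.tsum_add]
          exact tsum_congr fun j => by ring
        rw [h1, ENNReal.tsum_add, ENNReal.tsum_mul_right, ENNReal.tsum_mul_right]
        ring
    _ ≤ _ := by gcongr; norm_num

end ENNReal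

namespace PositiveOperator

variable {𝕜 H I : Type*} [RCLike 𝕜] [NormedAddCommGroup H] [InnerProductSpace 𝕜 H]
  [CompleteSpace H] (L : PositiveOperator 𝕜 H I)

theorem one_add_eigenvalue_pos (k : I) : 0 < 1 + L.eigenvalue k := by
  linarith [L.eigenvalue_nonneg k]

theorem eNorm_sq (d : ℝ) (c : I → 𝕜) :
    L.eNorm d c ^ 2 = ∑' k, ENNReal.ofReal ((1 + L.eigenvalue k) ^ d) * ‖c k‖ₑ ^ 2 := by
  rw [eNorm, ← ENNReal.rpow_natCast, ← ENNReal.rpow_mul]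
  norm_num

theorem eNorm_le_iff {d : ℝ} {c : I → 𝕜} {M : ℝ≥0∞} :
    L.eNorm d c ≤ M ↔
      ∑' k, ENNReal.ofReal ((1 + L.eigenvalue k) ^ d) * ‖c k‖ₑ ^ 2 ≤ M ^ 2 := by
  rw [← eNorm_sq, ENNReal.pow_le_pow_left_iff two_ne_zero]

/-- Multipliers between Sobolev spaces. -/
theorem eNorm_le_mul_of_norm_le {d d' : ℝ} {K : ℝ≥0} {a b : I → 𝕜}
    (h : ∀ k, (1 + L.eigenvalue k) ^ ((d - d') / 2) * ‖a k‖ ≤ K * ‖b k‖) :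
    L.eNorm d a ≤ K * L.eNorm d' b := by
  rw [eNorm_le_iff, mul_pow, eNorm_sq, ← ENNReal.tsum_mul_left]
  refine ENNReal.tsum_le_tsum fun k => ?_
  have hk := L.one_add_eigenvalue_pos k
  have e : (1 + L.eigenvalue k) ^ d
      = (1 + L.eigenvalue k) ^ d' * ((1 + L.eigenvalue k) ^ ((d - d') / 2)) ^ 2 := by
    rw [← Real.rpow_natCast, ← Real.rpow_mul hk.le, ← Real.rpow_add hk]
    congr 1
    push_cast
    ring
  have h2 : ENNReal.ofReal ((1 + L.eigenvalue k) ^ ((d - d') / 2)) * ‖a k‖ₑ ≤ K * ‖b k‖ₑ := by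
    rw [← ofReal_norm, ← ofReal_norm, ← ENNReal.ofReal_mul (by positivity),
      ← ENNReal.ofReal_coe_nnreal, ← ENNReal.ofReal_mul (by positivity)]
    exact ENNReal.ofReal_le_ofReal (h k)
  calc ENNReal.ofReal ((1 + L.eigenvalue k) ^ d) * ‖a k‖ₑ ^ 2
      = ENNReal.ofReal ((1 + L.eigenvalue k) ^ d') *
        (ENNReal.ofReal ((1 + L.eigenvalue k) ^ ((d - d') / 2)) * ‖a k‖ₑ) ^ 2 := by
        rw [e, ENNReal.ofReal_mul (by positivity), mul_pow, ENNReal.ofReal_pow (by positivity)]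
        ring
    _ ≤ ENNReal.ofReal ((1 + L.eigenvalue k) ^ d') * (K * ‖b k‖ₑ) ^ 2 := by gcongr
    _ = _ := by ring

/-- The factor 2 is lossy; it replaces Minkowski's inequality by `(a + b)² ≤ 4 (a² + b²)`. -/
theorem eNorm_add_le (d : ℝ) (a b : I → 𝕜) :
    L.eNorm d (a + b) ≤ 2 * (L.eNorm d a + L.eNorm d b) := by
  rw [eNorm_le_iff]
  calc ∑' k, ENNReal.ofReal ((1 + L.eigenvalue k) ^ d) * ‖(a + b) k‖ₑ ^ 2
      ≤ ∑' k, (4 * (ENNReal.ofReal ((1 + L.eigenvalue k) ^ d) * ‖a k‖ₑ ^ 2) +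
          4 * (ENNReal.ofReal ((1 + L.eigenvalue k) ^ d) * ‖b k‖ₑ ^ 2)) := by
        refine ENNReal.tsum_le_tsum fun k => ?_
        calc _ ≤ ENNReal.ofReal ((1 + L.eigenvalue k) ^ d) * (‖a k‖ₑ + ‖b k‖ₑ) ^ 2 := by
              gcongr
              exact enorm_add_le _ _
          _ ≤ ENNReal.ofReal ((1 + L.eigenvalue k) ^ d) * (4 * (‖a k‖ₑ ^ 2 + ‖b k‖ₑ ^ 2)) := by
              gcongr
              exact ENNReal.add_sq_le_four_mul _ _
          _ = _ := by ring
    _ = 4 * (L.eNorm d a ^ 2 + L.eNorm d b ^ 2) := by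
        rw [ENNReal.tsum_add, ENNReal.tsum_mul_left, ENNReal.tsum_mul_left, ← eNorm_sq,
          ← eNorm_sq]
        ring
    _ ≤ 4 * (L.eNorm d a ^ 2 + L.eNorm d b ^ 2) + 8 * (L.eNorm d a * L.eNorm d b) := le_self_add
    _ = _ := by ring

theorem eNorm_smul (d r : ℝ) (c : I → 𝕜) : L.eNorm d (r • c) = ‖r‖ₑ * L.eNorm d c := by
  have h : ∀ {x y : ℝ≥0∞}, x ^ 2 = y ^ 2 → x = y := fun h =>
    (ENNReal.pow_right_strictMono two_ne_zero).injective h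
  refine h ?_
  rw [mul_pow, eNorm_sq, eNorm_sq, ← ENNReal.tsum_mul_left]
  refine tsum_congr fun k => ?_
  rw [Pi.smul_apply, enorm_smul]
  ring

theorem eNorm_sub_le (d : ℝ) (a b : I → 𝕜) :
    L.eNorm d (a - b) ≤ 2 * (L.eNorm d a + L.eNorm d b) := by
  have h := L.eNorm_add_le d a ((-1 : ℝ) • b)
  rw [eNorm_smul, enorm_neg, enorm_one, one_mul] at h
  simpa [sub_eq_add_neg] using h

/-- Weighted averages over a lattice are bounded in the Sobolev norms. -/
theorem eNorm_le_of_enorm_le_tsum {q : ℝ} (hq0 : 0 < q) (hq1 : q < 1) {d : ℝ} {c : I → 𝕜}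
    {g : ℕ → I → 𝕜} {A M : ℝ≥0∞} (hM : ∀ j, L.eNorm d (g j) ≤ M)
    (h : ∀ k, ‖c k‖ₑ ≤ A * ∑' j : ℕ, ENNReal.ofReal (q ^ j) * ‖g j k‖ₑ) :
    L.eNorm d c ≤ 2 * A * ENNReal.ofReal (1 - q)⁻¹ * M := by
  set Q := ∑' j : ℕ, ENNReal.ofReal (q ^ j) with hQ
  have hQ' : Q = ENNReal.ofReal (1 - q)⁻¹ := by
    rw [hQ, ← tsum_geometric_of_lt_one hq0.le hq1, ENNReal.ofReal_tsum_of_nonneg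
      (fun j => by positivity) (summable_geometric_of_lt_one hq0.le hq1)]
  rw [← hQ', eNorm_le_iff]
  calc ∑' k, ENNReal.ofReal ((1 + L.eigenvalue k) ^ d) * ‖c k‖ₑ ^ 2
      ≤ ∑' k, ∑' j : ℕ, 4 * A ^ 2 * Q * (ENNReal.ofReal (q ^ j) *
          (ENNReal.ofReal ((1 + L.eigenvalue k) ^ d) * ‖g j k‖ₑ ^ 2)) := by
        refine ENNReal.tsum_le_tsum fun k => ?_
        calc _ ≤ ENNReal.ofReal ((1 + L.eigenvalue k) ^ d) *
              (A * ∑' j : ℕ, ENNReal.ofReal (q ^ j) * ‖g j k‖ₑ) ^ 2 := by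
              gcongr
              exact h k
          _ ≤ ENNReal.ofReal ((1 + L.eigenvalue k) ^ d) *
              (A ^ 2 * (4 * Q * ∑' j : ℕ, ENNReal.ofReal (q ^ j) * ‖g j k‖ₑ ^ 2)) := by
              rw [mul_pow]
              gcongr
              exact ENNReal.tsum_mul_sq_le _ _
          _ = _ := by
              have e : ∑' j : ℕ, ENNReal.ofReal (q ^ j) *
                  (ENNReal.ofReal ((1 + L.eigenvalue k) ^ d) * ‖g j k‖ₑ ^ 2)
                  = ENNReal.ofReal ((1 + L.eigenvalue k) ^ d) *
                    ∑' j : ℕ, ENNReal.ofReal (q ^ j) * ‖g j k‖ₑ ^ 2 := by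
                rw [← ENNReal.tsum_mul_left]
                exact tsum_congr fun j => by ring
              rw [ENNReal.tsum_mul_left, e]
              ring
    _ = 4 * A ^ 2 * Q * ∑' j : ℕ, ENNReal.ofReal (q ^ j) * L.eNorm d (g j) ^ 2 := by
        rw [ENNReal.tsum_comm]
        simp only [ENNReal.tsum_mul_left, ← eNorm_sq]
    _ ≤ 4 * A ^ 2 * Q * ∑' j : ℕ, ENNReal.ofReal (q ^ j) * M ^ 2 := by
        gcongr
        exact hM _
    _ = _ := by
        rw [ENNReal.tsum_mul_right, ← hQ]
        ring

theorem enorm_apply_le (d : ℝ) (c : I → 𝕜) (k : I) :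
    ‖c k‖ₑ ≤ ENNReal.ofReal ((1 + L.eigenvalue k) ^ (-(d / 2))) * L.eNorm d c := by
  have hk := L.one_add_eigenvalue_pos k
  rw [← ENNReal.pow_le_pow_left_iff two_ne_zero, mul_pow, eNorm_sq,
    ← ENNReal.ofReal_pow (by positivity)]
  have e : ((1 + L.eigenvalue k) ^ (-(d / 2))) ^ 2 * (1 + L.eigenvalue k) ^ d = 1 := by
    rw [← Real.rpow_natCast, ← Real.rpow_mul hk.le, ← Real.rpow_add hk]
    norm_num
  calc ‖c k‖ₑ ^ 2 = ENNReal.ofReal (((1 + L.eigenvalue k) ^ (-(d / 2))) ^ 2) *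
        (ENNReal.ofReal ((1 + L.eigenvalue k) ^ d) * ‖c k‖ₑ ^ 2) := by
        rw [← mul_assoc, ← ENNReal.ofReal_mul (by positivity), e, ENNReal.ofReal_one, one_mul]
    _ ≤ _ := by
        gcongr
        exact ENNReal.le_tsum (f := fun k =>
          ENNReal.ofReal ((1 + L.eigenvalue k) ^ d) * ‖c k‖ₑ ^ 2) k

/-- The bound depends on `k`. It serves only to justify scalar convergence and uniqueness and does
not enter the final constant. -/
theorem exists_norm_apply_le (d : ℝ) (k : I) {M : ℝ≥0∞} (hM : M < ∞) :
    ∃ B : ℝ, ∀ c : I → 𝕜, L.eNorm d c ≤ M → ‖c k‖ ≤ B := by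
  refine ⟨(ENNReal.ofReal ((1 + L.eigenvalue k) ^ (-(d / 2))) * M).toReal, fun c hc => ?_⟩
  rw [← toReal_enorm]
  refine ENNReal.toReal_mono (ENNReal.mul_ne_top ENNReal.ofReal_ne_top hM.ne) ?_
  exact (L.enorm_apply_le d c k).trans (by gcongr)

theorem summable_norm_apply {d : ℝ} {c : ℕ → I → 𝕜} (h : ∑' n, L.eNorm d (c n) < ∞) (k : I) :
    Summable fun n => ‖c n k‖ := by
  have h1 : ∑' n, ‖c n k‖ₑ ≠ ∞ := by
    refine ne_top_of_le_ne_top (ENNReal.mul_ne_top (ENNReal.ofReal_ne_top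
      (r := (1 + L.eigenvalue k) ^ (-(d / 2)))) h.ne) ?_
    rw [← ENNReal.tsum_mul_left]
    exact ENNReal.tsum_le_tsum fun n => L.enorm_apply_le d (c n) k
  simpa using ENNReal.summable_toReal h1

theorem tendsto_apply_of_eNorm {d : ℝ} {c : ℕ → I → 𝕜} {ρ : I → 𝕜}
    (h : Tendsto (fun n => L.eNorm d (c n - ρ)) atTop (𝓝 0)) (k : I) :
    Tendsto (fun n => c n k) atTop (𝓝 (ρ k)) := by
  rw [tendsto_iff_edist_tendsto_0]
  have h2 := ENNReal.Tendsto.const_mul (a := ENNReal.ofReal ((1 + L.eigenvalue k) ^ (-(d / 2)))) h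
    (Or.inr ENNReal.ofReal_ne_top)
  rw [mul_zero] at h2
  refine tendsto_of_tendsto_of_tendsto_of_le_of_le tendsto_const_nhds h2 (fun _ => zero_le) ?_
  intro n
  simp only [edist_eq_enorm_sub]
  exact L.enorm_apply_le d (c n - ρ) k

end PositiveOperator

/-! ### Scalar Volterra equations on the lattice -/

section Scalar

variable {E : Type*} [NormedAddCommGroup E] [NormedSpace ℝ E] {q : ℝ}

theorem fracOp_zero {t : ℝ} (g : ℝ → E) : fracOp q 0 g t = g t := by
  rw [fracOp, tsum_eq_single 0]
  · simp
  · intro j hj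
    rw [Real.rpow_zero, qPochFin_one_left, if_neg hj]
    simp

theorem fracOp_sub_smul [CompleteSpace E] (hq0 : 0 < q) (hq1 : q < 1) (a μ : ℝ) {t : ℝ}
    {g v : ℝ → E} (hg : Summable fun n : ℕ => q ^ n * ‖g (t * q ^ n)‖)
    (hv : Summable fun n : ℕ => q ^ n * ‖v (t * q ^ n)‖) :
    fracOp q a (fun s => g s - μ • v s) t = fracOp q a g t - μ • fracOp q a v t := by
  rw [fracOp, fracOp, fracOp, smul_comm μ, ← smul_sub]
  congr 1
  rw [← tsum_const_smul'', ← Summable.tsum_sub (summable_fracOp hq0 hq1 _ hg)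
      ((summable_fracOp hq0 hq1 _ hv).const_smul _)]
  exact tsum_congr fun j => by rw [smul_sub, smul_comm μ]

theorem mem_Ioc_mul_pow (hq0 : 0 < q) (hq1 : q < 1) {t T : ℝ} (ht : t ∈ Set.Ioc 0 T) (n : ℕ) :
    t * q ^ n ∈ Set.Ioc 0 T :=
  ⟨mul_pos ht.1 (pow_pos hq0 n),
    (mul_le_of_le_one_right ht.1.le (pow_le_one₀ hq0.le hq1.le)).trans ht.2⟩

theorem qDeriv_add_mul_add_fracOp [CompleteSpace E] (hq0 : 0 < q) (hq1 : q < 1) {α T : ℝ}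
    {x y : E} {G u : ℝ → E}
    (hG : ∀ t ∈ Set.Ioc 0 T, Summable fun n : ℕ => q ^ n * ‖G (t * q ^ n)‖)
    (hu : ∀ t ∈ Set.Ioc 0 T, u t = x + t • y + fracOp q α G t) {t : ℝ} (ht : t ∈ Set.Ioc 0 T) :
    (qDeriv q)^[2] u t = fracOp q (α - 2) G t := by
  have h1q : 0 < 1 - q := by linarith
  have hqt : ∀ s ∈ Set.Ioc 0 T, q * s ∈ Set.Ioc 0 T := fun s hs => by
    simpa [mul_comm] using mem_Ioc_mul_pow hq0 hq1 hs 1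
  have h1 : ∀ s ∈ Set.Ioc 0 T, qDeriv q u s = y + fracOp q (α - 1) G s := fun s hs => by
    rw [← qDeriv_fracOp hq0 hq1 α hs.1 (hG s hs), qDeriv, qDeriv, hu s hs, hu _ (hqt s hs)]
    have e : (s * (1 - q))⁻¹ • (s * (1 - q)) • y = y := by
      rw [smul_smul, inv_mul_cancel₀ (mul_pos hs.1 h1q).ne', one_smul]
    refine Eq.trans ?_ (congrArg (· + _) e)
    rw [← smul_add]
    congr 1
    module
  have h2 := qDeriv_fracOp hq0 hq1 (α - 1) ht.1 (hG t ht)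
  rw [show α - 1 - 1 = α - 2 by ring] at h2
  rw [← h2]
  show qDeriv q (qDeriv q u) t = _
  rw [qDeriv, h1 t ht, h1 _ (hqt t ht), qDeriv]
  congr 1
  abel

theorem norm_resolventOp_le (hq0 : 0 < q) (hq1 : q < 1) {α μ t M : ℝ} (hα : 0 < α)
    (hμ : 0 < μ) (ht : 0 < t) {g : ℝ → E} (hg : ∀ n : ℕ, ‖g (t * q ^ n)‖ ≤ M) :
    ‖resolventOp q α μ g t‖
      ≤ μ⁻¹ * (2 * Real.exp (1 / (1 - q)) / qPochInf q q * ((1 - q)⁻¹ * M)) := by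
  have h := norm_smul_resolventOp_le hq0 hq1 hα hμ.le ht g
  have hκ := qPochInf_pos hq0 hq1 hq1
  have h1q : 0 < 1 - q := by linarith
  have hM : 0 ≤ M := (norm_nonneg _).trans (hg 0)
  have h2 : ∑' j : ℕ, ENNReal.ofReal (q ^ j) * ‖g (t * q ^ j)‖ₑ
      ≤ ENNReal.ofReal ((1 - q)⁻¹ * M) := by
    rw [← tsum_geometric_of_lt_one hq0.le hq1, ← tsum_mul_right,
      ENNReal.ofReal_tsum_of_nonneg (fun j => by positivity)
        ((summable_geometric_of_lt_one hq0.le hq1).mul_right M)]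
    refine ENNReal.tsum_le_tsum fun j => ?_
    rw [ENNReal.ofReal_mul (by positivity), ← ofReal_norm]
    gcongr
    exact hg j
  have h3 := h.trans (mul_le_mul_right h2 _)
  rw [← ENNReal.ofReal_mul (by positivity), ← ofReal_norm,
    ENNReal.ofReal_le_ofReal_iff (by positivity), norm_smul, Real.norm_of_nonneg hμ.le] at h3
  rw [inv_mul_eq_div, le_div_iff₀ hμ, mul_comm]
  exact h3

theorem resolventOp_volterra [CompleteSpace E] (hq0 : 0 < q) (hq1 : q < 1) {α μ T M : ℝ}
    (hα : 0 < α) (hμ : 0 < μ) {g : ℝ → E} (hg : ∀ t ∈ Set.Ioc 0 T, ‖g t‖ ≤ M) {t : ℝ}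
    (ht : t ∈ Set.Ioc 0 T) :
    resolventOp q α μ g t = fracOp q α (fun s => g s - μ • resolventOp q α μ g s) t := by
  have hmem := mem_Ioc_mul_pow hq0 hq1 ht
  have hgt : ∀ s ∈ Set.Ioc 0 T, ∀ n : ℕ, ‖g (s * q ^ n)‖ ≤ M := fun s hs n =>
    hg _ (mem_Ioc_mul_pow hq0 hq1 hs n)
  rw [fracOp_sub_smul hq0 hq1 α μ (summable_of_bounded hq0 hq1 (hgt t ht))
    (summable_of_bounded hq0 hq1 fun n => norm_resolventOp_le hq0 hq1 hα hμ (hmem n).1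
      (hgt _ (hmem n)))]
  exact resolventOp_eq hq0 hq1 hα hμ.le ht.1 (hgt t ht)

/-- A solution of the Caputo problem solves the Volterra equation. -/
theorem eq_add_fracOp_of_caputo [CompleteSpace E] (hq0 : 0 < q) (hq1 : q < 1) {α : ℝ}
    (hα2 : α < 2) {t : ℝ} (ht : 0 < t) {v F : ℝ → E} {ρ : E}
    (hs : Summable fun n : ℕ => q ^ n * ‖(qDeriv q)^[2] v (t * q ^ n)‖)
    (hρ : Tendsto (fun n : ℕ => (t * q ^ n)⁻¹ • (v (t * q ^ n) - v 0)) atTop (𝓝 ρ))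
    (hF : ∀ n : ℕ, fracOp q (2 - α) ((qDeriv q)^[2] v) (t * q ^ n) = F (t * q ^ n)) :
    v t = v 0 + t • ρ + fracOp q α F t := by
  have h := fracOp_two_qDeriv hq0 hq1 ht hs hρ
  have h2 := fracOp_fracOp hq0 hq1 α (2 - α) ht (summable_geom_mul_summable
    (g := fun n => (qDeriv q)^[2] v (t * q ^ n)) hq0 (by positivity)
    (Real.rpow_lt_one hq0.le hq1 (by linarith : 0 < 2 - α)) hs)
  rw [add_sub_cancel, h, fracOp_congr hF] at h2
  rw [h2]
  abel

theorem summable_resolvent_coeff (hq0 : 0 < q) (hq1 : q < 1) {r x w : ℝ} (hr0 : 0 ≤ r)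
    (hx0 : 0 ≤ x) (hx1 : x < 1) (hw : w ≤ 0) (a : ℝ) :
    Summable fun j : ℕ => x ^ j * (geomFunctional r w (qPochPoly a q j) / qPochFin q q j) := by
  refine Summable.of_norm_bounded ((summable_geometric_of_lt_one hx0 hx1).mul_right
    (Real.exp (|a| / (1 - q)) / qPochInf q q)) fun j => ?_
  rw [norm_mul, Real.norm_of_nonneg (by positivity), Real.norm_eq_abs, abs_div,
    abs_of_pos (qPochFin_pos hq0 hq1 hq1 j)]
  gcongr
  · exact qPochInf_pos hq0 hq1 hq1
  · exact abs_geomFunctional_qPochPoly_le hr0 hw hq0 hq1 a j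
  · exact qPochInf_le_qPochFin hq0 hq1 hq0.le hq1 j

/-- The functional equation summed over `j`: since `(1;q)_j = 0` for `j > 0`, the constant comes
from `j = 0` alone. This expresses the Mittag-Leffler functions through the resolvent weights. -/
theorem geomSeries_one (hq0 : 0 < q) (hq1 : q < 1) {r x w : ℝ} (hr0 : 0 ≤ r) (hr1 : r ≤ 1)
    (hx0 : 0 ≤ x) (hx1 : x < 1) (hw : w ≤ 0) :
    geomSeries q r x 1 w = 1 + w * geomSeries q r x r w := by
  have h : ∀ j : ℕ, x ^ j * (geomFunctional r w (qPochPoly 1 q j) / qPochFin q q j)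
      = (if j = 0 then 1 else 0)
        + w * (x ^ j * (geomFunctional r w (qPochPoly r q j) / qPochFin q q j)) := fun j => by
    have h1 := mul_geomFunctional_qPochPoly r w 1 q
      (fun n => (one_sub_mul_pow_pos hr0 hr1 (by linarith) n).ne') j
    rw [one_mul, qPochFin_one_left] at h1
    rw [eq_add_of_sub_eq h1.symm]
    split_ifs with hj
    · subst hj; simp; ring
    · ring
  rw [geomSeries, geomSeries, ← tsum_mul_left]
  simp only [h]
  rw [Summable.tsum_add (summable_of_ne_finset_zero (s := {0}) fun j hj => by
      rw [if_neg (by simpa using hj)])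
    ((summable_resolvent_coeff hq0 hq1 hr0 hx0 hx1 hw r).mul_left w), tsum_ite_eq]

end Scalar

/-! ### The Caputo derivative as a fractional operator on the lattice -/

section Caputo

variable {q α : ℝ}

theorem qPochInf_le_one (hq0 : 0 < q) (hq1 : q < 1) {a : ℝ} (ha0 : 0 ≤ a) (ha1 : a < 1) :
    qPochInf a q ≤ 1 :=
  (qPochInf_le_qPochFin hq0 hq1 ha0 ha1 0).trans_eq (qPochFin_zero a q)

theorem qPochInf_le_qPochInf_mul_pow (hq0 : 0 < q) (hq1 : q < 1) {a : ℝ} (ha0 : 0 ≤ a)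
    (ha1 : a < 1) (j : ℕ) : qPochInf a q ≤ qPochInf (a * q ^ j) q := by
  rw [← qPochFin_mul_qPochInf hq0 hq1 a j]
  exact mul_le_of_le_one_left (qPochInf_pos hq0 hq1 (mul_pow_lt_one hq0 hq1 ha1 j)).le
    (qPochFin_le_one hq0 hq1 ha0 ha1 j)

/-- With `qPowKernel_le` this makes the kernel comparable to `t^(a-1)` uniformly on the lattice, so
absolute convergence of the Jackson integral amounts to summability against `q^n`. -/
theorem le_qPowKernel (hq0 : 0 < q) (hq1 : q < 1) {a t : ℝ} (ha : 0 < a) (ht : 0 < t) (j : ℕ) :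
    t ^ (a - 1) * qPochInf q q ≤ qPowKernel q (a - 1) t (t * q ^ j) := by
  have hr0 : 0 < q ^ a := Real.rpow_pos_of_pos hq0 _
  have hr1 : q ^ a < 1 := Real.rpow_lt_one hq0.le hq1 ha
  have h1 := qPochInf_pos hq0 hq1 (mul_pow_lt_one hq0 hq1 hr1 j)
  rw [qPowKernel_lattice hq0 _ ht, sub_add_cancel]
  refine mul_le_mul_of_nonneg_left ?_ (by positivity)
  rw [le_div_iff₀ h1]
  calc qPochInf q q * qPochInf (q ^ a * q ^ j) q ≤ qPochInf q q * 1 :=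
        mul_le_mul_of_nonneg_left (qPochInf_le_one hq0 hq1 (by positivity)
          (mul_pow_lt_one hq0 hq1 hr1 j)) (qPochInf_pos hq0 hq1 hq1).le
    _ ≤ _ := by
        rw [mul_one]
        exact qPochInf_le_qPochInf_mul_pow hq0 hq1 hq0.le hq1 j

theorem qPowKernel_le (hq0 : 0 < q) (hq1 : q < 1) {a t : ℝ} (ha : 0 < a) (ht : 0 < t) (j : ℕ) :
    qPowKernel q (a - 1) t (t * q ^ j) ≤ t ^ (a - 1) * (qPochInf (q ^ a) q)⁻¹ := by
  have hr0 : 0 < q ^ a := Real.rpow_pos_of_pos hq0 _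
  have hr1 : q ^ a < 1 := Real.rpow_lt_one hq0.le hq1 ha
  have h1 := qPochInf_pos hq0 hq1 hr1
  rw [qPowKernel_lattice hq0 _ ht, sub_add_cancel, ← one_div]
  refine mul_le_mul_of_nonneg_left ?_ (by positivity)
  exact div_le_div₀ zero_le_one (qPochInf_le_one hq0 hq1 (by positivity)
    (mul_pow_lt_one hq0 hq1 hq1 j)) h1 (qPochInf_le_qPochInf_mul_pow hq0 hq1 hr0.le hr1 j)

theorem qPowKernel_lattice_eq (hq0 : 0 < q) (hq1 : q < 1) {a t : ℝ} (ha : 0 < a) (ht : 0 < t)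
    (j : ℕ) : qPowKernel q (a - 1) t (t * q ^ j) = t ^ (a - 1) *
      (qPochInf q q / qPochInf (q ^ a) q) * (qPochFin (q ^ a) q j / qPochFin q q j) := by
  have hr1 : q ^ a < 1 := Real.rpow_lt_one hq0.le hq1 ha
  have h1 := (qPochInf_pos hq0 hq1 (mul_pow_lt_one hq0 hq1 hr1 j)).ne'
  have h3 := (qPochFin_pos hq0 hq1 hq1 j).ne'
  have h4 := (qPochFin_pos hq0 hq1 hr1 j).ne'
  rw [qPowKernel_lattice hq0 _ ht, sub_add_cancel, ← qPochFin_mul_qPochInf hq0 hq1 q j,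
    ← qPochFin_mul_qPochInf hq0 hq1 (q ^ a) j]
  field_simp

theorem rlIntegral_eq_fracOp {E : Type*} [NormedAddCommGroup E] [NormedSpace ℝ E]
    (hq0 : 0 < q) (hq1 : q < 1) {a t : ℝ} (ha : 0 < a) (ht : 0 < t) (g : ℝ → E) :
    rlIntegral q a g t = fracOp q a g t := by
  have h1q : 0 < 1 - q := by linarith
  have hr1 : q ^ a < 1 := Real.rpow_lt_one hq0.le hq1 ha
  have h1 := (qPochInf_pos hq0 hq1 hr1).ne'
  have h2 := (qPochInf_pos hq0 hq1 hq1).ne'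
  have hterm : ∀ n : ℕ, q ^ n • qPowKernel q (a - 1) t (t * q ^ n) • g (t * q ^ n)
      = (t ^ (a - 1) * (qPochInf q q / qPochInf (q ^ a) q)) •
        (q ^ n * (qPochFin (q ^ a) q n / qPochFin q q n)) • g (t * q ^ n) := fun n => by
    rw [qPowKernel_lattice_eq hq0 hq1 ha ht, smul_smul, smul_smul]
    congr 1
    ring
  rw [rlIntegral, jacksonIntegral, fracOp, inv_qGamma hq1]
  simp only [hterm]
  rw [tsum_const_smul'', smul_smul, smul_smul]
  congr 1
  rw [Real.rpow_sub_one h1q.ne', Real.rpow_sub_one ht.ne']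
  field_simp

theorem ceil_eq_two (hα1 : 1 < α) (hα2 : α < 2) : ⌈α⌉₊ = 2 := by
  rw [Nat.ceil_eq_iff two_ne_zero]
  constructor <;> norm_num <;> linarith

variable {I 𝕜 : Type*} [RCLike 𝕜]

theorem qDeriv_iterate_apply (n : ℕ) (u : ℝ → I → 𝕜) (s : ℝ) (k : I) :
    (qDeriv q)^[n] u s k = (qDeriv q)^[n] (fun s => u s k) s := by
  induction n generalizing u with
  | zero => rfl
  | succ n ih =>
    rw [Function.iterate_succ_apply, Function.iterate_succ_apply, ih]
    rfl

theorem caputo_apply (hq0 : 0 < q) (hq1 : q < 1) (hα1 : 1 < α) (hα2 : α < 2) {t : ℝ} (ht : 0 < t)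
    {u : ℝ → I → 𝕜} (hs : ∀ k, Summable fun n : ℕ =>
      q ^ n * ‖(qDeriv q)^[2] (fun s => u s k) (t * q ^ n)‖) (k : I) :
    caputo q α u t k = fracOp q (2 - α) ((qDeriv q)^[2] (fun s => u s k)) t := by
  have ha : 0 < 2 - α := by linarith
  rw [← rlIntegral_eq_fracOp hq0 hq1 ha ht, caputo, ceil_eq_two hα1 hα2, rlIntegral, rlIntegral,
    jacksonIntegral, jacksonIntegral, Nat.cast_ofNat]
  -- The series lives in the product topology of `I → 𝕜`, so coordinatewise summability permits
  -- evaluation at `k`.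
  have hsum : Summable fun n : ℕ => q ^ n • qPowKernel q (2 - α - 1) t (t * q ^ n) •
      (qDeriv q)^[2] u (t * q ^ n) := by
    refine Pi.summable.2 fun i => ?_
    refine Summable.of_norm_bounded
      ((hs i).mul_left (t ^ (2 - α - 1) * (qPochInf (q ^ (2 - α)) q)⁻¹)) fun n => ?_
    have h0 := (by have := qPochInf_pos hq0 hq1 hq1; positivity :
      0 ≤ t ^ (2 - α - 1) * qPochInf q q).trans (le_qPowKernel hq0 hq1 ha ht n)
    rw [Pi.smul_apply, Pi.smul_apply, qDeriv_iterate_apply, norm_smul, norm_smul,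
      Real.norm_of_nonneg (by positivity : 0 ≤ q ^ n), Real.norm_of_nonneg h0, mul_left_comm]
    gcongr
    exact qPowKernel_le hq0 hq1 ha ht n
  rw [Pi.smul_apply, Pi.smul_apply, tsum_apply hsum]
  simp only [Pi.smul_apply, qDeriv_iterate_apply]

theorem caputo_zero_right (u : ℝ → I → 𝕜) : caputo q α u 0 = 0 := by
  simp [caputo, rlIntegral, jacksonIntegral]

end Caputo

/-! ### Volterra representations and the Caputo derivative in the Sobolev scale -/

namespace PositiveOperator

variable {𝕜 H I : Type*} [RCLike 𝕜] [NormedAddCommGroup H] [InnerProductSpace 𝕜 H]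
  [CompleteSpace H] (L : PositiveOperator 𝕜 H I) {q α m d T : ℝ}

theorem HasCaputo.summable {L : PositiveOperator 𝕜 H I} (hq0 : 0 < q) (hq1 : q < 1) (hα1 : 1 < α)
    (hα2 : α < 2) {u : ℝ → I → 𝕜} (hu : L.HasCaputo q α d T u) {t : ℝ} (ht : t ∈ Set.Ioc 0 T)
    (k : I) : Summable fun n : ℕ => q ^ n * ‖(qDeriv q)^[2] (fun s => u s k) (t * q ^ n)‖ := by
  have ha : 0 < 2 - α := by linarith
  have h := hu t ht
  rw [ceil_eq_two hα1 hα2, Nat.cast_ofNat] at h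
  have ht0 := ht.1
  have hc : 0 < t ^ (2 - α - 1) * qPochInf q q := by
    have := qPochInf_pos hq0 hq1 hq1
    positivity
  refine Summable.of_nonneg_of_le (fun n => by positivity) (fun n => ?_)
    ((L.summable_norm_apply h k).mul_left (t ^ (2 - α - 1) * qPochInf q q)⁻¹)
  have hn := le_qPowKernel hq0 hq1 ha ht.1 n
  rw [Pi.smul_apply, Pi.smul_apply, qDeriv_iterate_apply, norm_smul, norm_smul,
    Real.norm_of_nonneg (by positivity : 0 ≤ q ^ n), Real.norm_of_nonneg (hc.le.trans hn),
    le_inv_mul_iff₀ hc, mul_left_comm]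
  gcongr

/-- Functions `φ + t ρ + I^α G` with bounded `G` have Caputo derivative `G`. -/
theorem caputo_of_volterra (hq0 : 0 < q) (hq1 : q < 1) (hα1 : 1 < α) (hα2 : α < 2)
    {B : ℝ≥0∞} (hB : B < ∞) {φ ρ : I → 𝕜} {u G : ℝ → I → 𝕜}
    (hG : ∀ s ∈ Set.Ioc 0 T, L.eNorm d (G s) ≤ B)
    (hu : ∀ t ∈ Set.Ioc 0 T, ∀ k, u t k = φ k + t • ρ k + fracOp q α (fun s => G s k) t) :
    L.HasCaputo q α d T u ∧ (∀ t ∈ Set.Ioc 0 T, caputo q α u t = G t) ∧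
      (u 0 = φ → L.HasQDerivAtZero q d T u ρ) := by
  have ha : 0 < 2 - α := by linarith
  have h1q : 0 < 1 - q := by linarith
  have hκ := qPochInf_pos hq0 hq1 hq1
  have hmem := fun {t : ℝ} (ht : t ∈ Set.Ioc 0 T) => mem_Ioc_mul_pow hq0 hq1 ht
  have hGk : ∀ k, ∃ M : ℝ, ∀ s ∈ Set.Ioc 0 T, ‖G s k‖ ≤ M := fun k => by
    obtain ⟨M, hM⟩ := L.exists_norm_apply_le d k hB
    exact ⟨M, fun s hs => hM _ (hG s hs)⟩
  have hbound : ∀ (b : ℝ) (s : ℝ), s ∈ Set.Ioc 0 T →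
      ∀ c : I → 𝕜, (∀ k, c k = fracOp q b (fun s => G s k) s) → L.eNorm d c ≤
        2 * ENNReal.ofReal ((1 - q) ^ b * (Real.exp (|q ^ b| / (1 - q)) / qPochInf q q)
          * s ^ b) * ENNReal.ofReal (1 - q)⁻¹ * B := by
    intro b s hs c hc
    refine L.eNorm_le_of_enorm_le_tsum hq0 hq1 (g := fun j => G (s * q ^ j))
      (fun j => hG _ (hmem hs j)) fun k => ?_
    rw [hc k]
    exact norm_fracOp_le hq0 hq1 b hs.1 fun s => G s k
  have hD : ∀ t ∈ Set.Ioc 0 T, ∀ k, (qDeriv q)^[2] (fun s => u s k) t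
      = fracOp q (α - 2) (fun s => G s k) t := fun t ht k => by
    obtain ⟨M, hM⟩ := hGk k
    exact qDeriv_add_mul_add_fracOp hq0 hq1
      (fun t ht => summable_of_bounded hq0 hq1 fun n => hM _ (hmem ht n))
      (fun t ht => hu t ht k) ht
  -- The exponent is `α - 1 > 0`: the singularity of `D_q² u` at 0, of order `s^(α-2)`, is
  -- integrable.
  have hx1 : q ^ (α - 2) * q < 1 := by
    rw [← Real.rpow_add_one hq0.ne']
    exact Real.rpow_lt_one hq0.le hq1 (by linarith)
  have hcap : L.HasCaputo q α d T u := by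
    intro t ht
    have ht0 := ht.1
    rw [ceil_eq_two hα1 hα2, Nat.cast_ofNat]
    set K := (1 - q) ^ (α - 2) * (Real.exp (|q ^ (α - 2)| / (1 - q)) / qPochInf q q) with hK
    have hK0 : 0 ≤ K := by positivity
    set κ := t ^ (2 - α - 1) * (qPochInf (q ^ (2 - α)) q)⁻¹ with hκ'
    have hκ0 : 0 ≤ κ := by
      have := qPochInf_pos hq0 hq1 (Real.rpow_lt_one hq0.le hq1 ha)
      positivity
    have hterm : ∀ n : ℕ, L.eNorm d (q ^ n • qPowKernel q (2 - α - 1) t (t * q ^ n) •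
        (qDeriv q)^[2] u (t * q ^ n)) ≤ ENNReal.ofReal (κ * (K * t ^ (α - 2)) *
          (q ^ (α - 2) * q) ^ n) * (2 * ENNReal.ofReal (1 - q)⁻¹ * B) := fun n => by
      have h0 := (by positivity : 0 ≤ t ^ (2 - α - 1) * qPochInf q q).trans
        (le_qPowKernel hq0 hq1 ha ht0 n)
      have h := hbound (α - 2) _ (hmem ht n) ((qDeriv q)^[2] u (t * q ^ n)) fun k => by
        rw [qDeriv_iterate_apply, hD _ (hmem ht n)]
      rw [← hK, mul_pow_rpow hq0 ht0] at h
      rw [eNorm_smul, eNorm_smul, Real.enorm_of_nonneg (by positivity), Real.enorm_of_nonneg h0]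
      calc _ ≤ ENNReal.ofReal (q ^ n) * (ENNReal.ofReal κ *
            (2 * ENNReal.ofReal (K * (t ^ (α - 2) * (q ^ (α - 2)) ^ n)) *
              ENNReal.ofReal (1 - q)⁻¹ * B)) := by
            gcongr
            exact qPowKernel_le hq0 hq1 ha ht0 n
        _ = ENNReal.ofReal (q ^ n) * ENNReal.ofReal κ *
            ENNReal.ofReal (K * (t ^ (α - 2) * (q ^ (α - 2)) ^ n)) *
            (2 * ENNReal.ofReal (1 - q)⁻¹ * B) := by ring
        _ = _ := by
            rw [← ENNReal.ofReal_mul (by positivity), ← ENNReal.ofReal_mul (by positivity)]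
            congr 2
            rw [mul_pow]
            ring
    refine (ENNReal.tsum_le_tsum hterm).trans_lt ?_
    rw [ENNReal.tsum_mul_right, ← ENNReal.ofReal_tsum_of_nonneg (fun n => by positivity)
      ((summable_geometric_of_lt_one (by positivity) hx1).mul_left _)]
    exact ENNReal.mul_lt_top ENNReal.ofReal_lt_top
      (ENNReal.mul_lt_top (ENNReal.mul_lt_top (by simp) ENNReal.ofReal_lt_top) hB)
  refine ⟨hcap, fun t ht => ?_, fun h0 t ht => ?_⟩
  · ext k
    obtain ⟨M, hM⟩ := hGk k
    have hs : Summable fun p : ℕ × ℕ =>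
        (q ^ (α - 2)) ^ p.1 * q ^ (p.1 + p.2) * ‖G (t * q ^ (p.1 + p.2)) k‖ :=
      summable_geom_mul_bounded (g := fun n => G (t * q ^ n) k) (M := M) hq0 hq1 (by positivity)
        hx1 fun n => hM (t * q ^ n) (hmem ht n)
    have hJ := fracOp_fracOp (g := fun s => G s k) hq0 hq1 (2 - α) (α - 2) ht.1 hs
    rw [show 2 - α + (α - 2) = 0 by ring, fracOp_zero] at hJ
    rw [caputo_apply hq0 hq1 hα1 hα2 ht.1 (fun k => hcap.summable hq0 hq1 hα1 hα2 ht k),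
      fracOp_congr fun j => hD _ (hmem ht j) k]
    exact hJ
  · have ht0 := ht.1
    set K := (1 - q) ^ α * (Real.exp (|q ^ α| / (1 - q)) / qPochInf q q) with hK
    have hK0 : 0 ≤ K := by positivity
    -- The remainder `I^α G` is of order `s^α`, so its difference quotient is of order `s^(α-1)` and
    -- tends to 0.
    have hle : ∀ n : ℕ, L.eNorm d ((t * q ^ n)⁻¹ • (u (t * q ^ n) - u 0) - ρ)
        ≤ ENNReal.ofReal (K * t ^ (α - 1) * (q ^ (α - 1)) ^ n) *
          (2 * ENNReal.ofReal (1 - q)⁻¹ * B) := fun n => by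
      have hs := (hmem ht n).1
      have e : (t * q ^ n)⁻¹ • (u (t * q ^ n) - u 0) - ρ
          = (t * q ^ n)⁻¹ • (fun k => fracOp q α (fun s => G s k) (t * q ^ n)) := by
        ext k
        simp only [Pi.sub_apply, Pi.smul_apply]
        rw [h0, hu _ (hmem ht n)]
        have : ρ k = (t * q ^ n)⁻¹ • (t * q ^ n) • ρ k := by
          rw [smul_smul, inv_mul_cancel₀ hs.ne', one_smul]
        nth_rewrite 2 [this]
        rw [← smul_sub]
        congr 1
        abel
      rw [e, eNorm_smul, Real.enorm_of_nonneg (inv_nonneg.2 hs.le)]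
      have h := hbound α _ (hmem ht n) _ fun k => rfl
      rw [← hK] at h
      calc _ ≤ _ := mul_le_mul_right h _
        _ = ENNReal.ofReal (t * q ^ n)⁻¹ * ENNReal.ofReal (K * (t * q ^ n) ^ α) *
            (2 * ENNReal.ofReal (1 - q)⁻¹ * B) := by ring
        _ = _ := by
            have e2 : (t * q ^ n)⁻¹ * (K * (t * q ^ n) ^ α)
                = K * t ^ (α - 1) * (q ^ (α - 1)) ^ n := by
              rw [mul_assoc K, ← mul_pow_rpow hq0 ht0, Real.rpow_sub_one hs.ne']
              field_simp
            rw [← ENNReal.ofReal_mul (inv_nonneg.2 hs.le), e2]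
    have hlim : Tendsto (fun n : ℕ => ENNReal.ofReal (K * t ^ (α - 1) * (q ^ (α - 1)) ^ n) *
        (2 * ENNReal.ofReal (1 - q)⁻¹ * B)) atTop (𝓝 0) := by
      have h1 := (tendsto_pow_atTop_nhds_zero_of_lt_one (by positivity)
        (Real.rpow_lt_one hq0.le hq1 (by linarith : 0 < α - 1))).const_mul (K * t ^ (α - 1))
      have h2 := ENNReal.Tendsto.mul_const (b := 2 * ENNReal.ofReal (1 - q)⁻¹ * B)
        (ENNReal.tendsto_ofReal h1) (Or.inr (ENNReal.mul_ne_top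
          (ENNReal.mul_ne_top (by simp) ENNReal.ofReal_ne_top) hB.ne))
      simpa using h2
    exact tendsto_of_tendsto_of_tendsto_of_le_of_le tendsto_const_nhds hlim
      (fun _ => zero_le) hle

end PositiveOperator

/-! ### Uniqueness for the inhomogeneous Volterra equation -/

theorem volterra_unique {E : Type*} [NormedAddCommGroup E] [NormedSpace ℝ E] [CompleteSpace E]
    {q α μ T Mf Mu Mv : ℝ} (hq0 : 0 < q) (hq1 : q < 1) (hα : 0 < α) (hμ : 0 ≤ μ)
    {x F u v : ℝ → E} (hF : ∀ s ∈ Set.Ioc 0 T, ‖F s‖ ≤ Mf) (hu : ∀ s ∈ Set.Ioc 0 T, ‖u s‖ ≤ Mu)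
    (hv : ∀ s ∈ Set.Ioc 0 T, ‖v s‖ ≤ Mv)
    (hu' : ∀ s ∈ Set.Ioc 0 T, u s = x s + fracOp q α (fun s => F s - μ • u s) s)
    (hv' : ∀ s ∈ Set.Ioc 0 T, v s = x s + fracOp q α (fun s => F s - μ • v s) s)
    {t : ℝ} (ht : t ∈ Set.Ioc 0 T) : v t = u t := by
  have hsum : ∀ {g : ℝ → E} {M : ℝ}, (∀ s ∈ Set.Ioc 0 T, ‖g s‖ ≤ M) → ∀ s ∈ Set.Ioc 0 T,
      Summable fun n : ℕ => q ^ n * ‖g (s * q ^ n)‖ := fun {g M} hg s hs =>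
    summable_of_bounded (g := fun n => g (s * q ^ n)) hq0 hq1
      fun n => hg (s * q ^ n) (mem_Ioc_mul_pow hq0 hq1 hs n)
  refine sub_eq_zero.1 (fracOp_volterra_unique (d := fun s => v s - u s) (M := Mv + Mu) hq0 hq1
    hα hμ (fun s hs => (norm_sub_le _ _).trans (add_le_add (hv s hs) (hu s hs)))
    (fun s hs => ?_) ht)
  have h := fracOp_sub_smul (g := v) (v := u) hq0 hq1 α 1 (hsum hv s hs) (hsum hu s hs)
  simp only [one_smul] at h
  rw [hv' s hs, hu' s hs, h, smul_sub, fracOp_sub_smul hq0 hq1 α μ (hsum hF s hs) (hsum hv s hs),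
    fracOp_sub_smul hq0 hq1 α μ (hsum hF s hs) (hsum hu s hs)]
  abel

namespace PositiveOperator

variable {𝕜 H I : Type*} [RCLike 𝕜] [NormedAddCommGroup H] [InnerProductSpace 𝕜 H]
  [CompleteSpace H] (L : PositiveOperator 𝕜 H I) {q α m d T : ℝ}

/-! ### The series solution -/

theorem duhamelIntegrand_lattice (hq0 : 0 < q) (hq1 : q < 1) (hα : 0 < α) (hm : 0 < m)
    (f : ℝ → I → 𝕜) {t : ℝ} (ht : 0 < t) (k : I) (j : ℕ) :
    q ^ j • L.duhamelIntegrand q α m f t k (t * q ^ j)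
      = (t ^ (α - 1) * (1 - q) ^ (α - 1)) • (q ^ j * (geomFunctional (q ^ α)
        (-(L.eigenvalue k + m) * t ^ α * (1 - q) ^ α) (qPochPoly (q ^ α) q j) /
          qPochFin q q j)) • f (t * q ^ j) k := by
  have hμ := L.eigenvalue_nonneg k
  rw [duhamelIntegrand, qPowKernel_mul_translate hq0 hq1 hα (by linarith) ht, smul_smul,
    smul_smul]
  congr 1
  ring

/-- The Mittag-Leffler factors split as `1 + w ∑ q^j p_j` and `1 + w ∑ q^(2j) p_j`. Their `w`-parts
are the resolvent applied to `-μφ` and to `-sμρ`, the extra `q^j` being `s/t` at the lattice point.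
-/
theorem seriesSolution_eq (hq0 : 0 < q) (hq1 : q < 1) (hα : 0 < α) (hm : 0 < m)
    (φ ρ : I → 𝕜) (f : ℝ → I → 𝕜) {t M : ℝ} (ht : 0 < t) (k : I)
    (hf : ∀ n : ℕ, ‖f (t * q ^ n) k‖ ≤ M) :
    JacksonIntegrable q t (L.duhamelIntegrand q α m f t k) ∧
    L.seriesSolution q α m φ ρ f t k = φ k + t • ρ k +
      resolventOp q α (L.eigenvalue k + m) (fun s => f s k - (L.eigenvalue k + m) • φ k
        - s • (L.eigenvalue k + m) • ρ k) t := by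
  have h1q : 0 < 1 - q := by linarith
  have hr0 : 0 < q ^ α := Real.rpow_pos_of_pos hq0 _
  have hr1 : q ^ α < 1 := Real.rpow_lt_one hq0.le hq1 hα
  set μ := L.eigenvalue k + m with hμ
  have hμ0 : 0 < μ := by linarith [L.eigenvalue_nonneg k]
  have hta : 0 < t ^ α := Real.rpow_pos_of_pos ht _
  have hz : -μ * t ^ α ≤ 0 := by nlinarith
  set w := -μ * t ^ α * (1 - q) ^ α with hw
  have h1a : 0 < (1 - q) ^ α := Real.rpow_pos_of_pos h1q _
  have hw0 : w ≤ 0 := mul_nonpos_of_nonpos_of_nonneg hz h1a.le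
  have h20 : 0 ≤ q ^ 2 := by positivity
  have h21 : q ^ 2 < 1 := pow_lt_one₀ hq0.le hq1 two_ne_zero
  set p : ℕ → ℝ := fun j => geomFunctional (q ^ α) w (qPochPoly (q ^ α) q j) / qPochFin q q j
    with hp
  have hp1 : Summable fun j => q ^ j * p j :=
    summable_resolvent_coeff hq0 hq1 hr0.le hq0.le hq1 hw0 _
  have hp2 : Summable fun j => (q ^ 2) ^ j * p j :=
    summable_resolvent_coeff hq0 hq1 hr0.le h20 h21 hw0 _
  have hf' : Summable fun j : ℕ => ‖(q ^ j * p j) • f (t * q ^ j) k‖ := by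
    refine Summable.of_nonneg_of_le (fun j => norm_nonneg _) (fun j => ?_) (hp1.norm.mul_right M)
    rw [norm_smul]
    gcongr
    exact hf j
  have hterm := L.duhamelIntegrand_lattice hq0 hq1 hα hm f ht k
  refine ⟨?_, ?_⟩
  · rw [JacksonIntegrable]
    simp only [hterm]
    refine (hf'.mul_left ‖t ^ (α - 1) * (1 - q) ^ (α - 1)‖).congr fun j => ?_
    rw [norm_smul (t ^ (α - 1) * (1 - q) ^ (α - 1))]
  have hJ : jacksonIntegral q t (L.duhamelIntegrand q α m f t k)
      = ((1 - q) ^ α * t ^ α) • ∑' j : ℕ, (q ^ j * p j) • f (t * q ^ j) k := by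
    rw [jacksonIntegral]
    simp only [hterm]
    rw [tsum_const_smul'', smul_smul]
    congr 1
    rw [Real.rpow_sub_one h1q.ne', Real.rpow_sub_one ht.ne']
    field_simp
  have hK : resolventOp q α μ (fun s => f s k - μ • φ k - s • μ • ρ k) t
      = ((1 - q) ^ α * t ^ α) • ((∑' j : ℕ, (q ^ j * p j) • f (t * q ^ j) k)
        - (∑' j : ℕ, q ^ j * p j) • μ • φ k - (∑' j : ℕ, (q ^ 2) ^ j * p j) • t • μ • ρ k) := by
    rw [resolventOp]
    congr 1
    rw [← hp1.tsum_smul_const, ← hp2.tsum_smul_const, ← Summable.tsum_sub hf'.of_norm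
      (hp1.smul_const _), ← Summable.tsum_sub (hf'.of_norm.sub (hp1.smul_const _))
      (hp2.smul_const _)]
    refine tsum_congr fun j => ?_
    rw [smul_sub, smul_sub, smul_smul _ (t * q ^ j), smul_smul _ t]
    congr 2
    simp only [hp]
    ring
  rw [seriesSolution, hJ, hK, ← hμ, qMittagLeffler_one hq0 hq1 hα hz,
    qMittagLeffler_two hq0 hq1 hα hz, ← hw,
    geomSeries_one hq0 hq1 hr0.le hr1.le hq0.le hq1 hw0,
    geomSeries_one hq0 hq1 hr0.le hr1.le h20 h21 hw0]
  change (1 + w * ∑' j : ℕ, q ^ j * p j) • φ k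
    + (t * (1 + w * ∑' j : ℕ, (q ^ 2) ^ j * p j)) • ρ k + _ = _
  rw [hw]
  module

theorem seriesSolution_zero (hq0 : 0 < q) (hq1 : q < 1) (hα : 0 < α)
    (φ ρ : I → 𝕜) (f : ℝ → I → 𝕜) : L.seriesSolution q α m φ ρ f 0 = φ := by
  have hr0 : 0 < q ^ α := Real.rpow_pos_of_pos hq0 _
  have hr1 : q ^ α < 1 := Real.rpow_lt_one hq0.le hq1 hα
  ext k
  rw [seriesSolution, Real.zero_rpow hα.ne', mul_zero, qMittagLeffler_one hq0 hq1 hα le_rfl,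
    zero_mul, geomSeries_one hq0 hq1 hr0.le hr1.le hq0.le hq1 le_rfl, jacksonIntegral]
  simp

theorem jacksonIntegrable_zero (hq0 : 0 < q) (hq1 : q < 1) {E : Type*} [NormedAddCommGroup E]
    [NormedSpace ℝ E] (g : ℝ → E) : JacksonIntegrable q 0 g := by
  rw [JacksonIntegrable]
  simp only [zero_mul, norm_smul, norm_pow, Real.norm_of_nonneg hq0.le]
  exact (summable_geometric_of_lt_one hq0.le hq1).mul_right _

/-! ### The operator `𝓛 + m` -/

/-- The operator `𝓛 + m` on `𝓛`-distributions. -/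
def shift (m : ℝ) (c : I → 𝕜) (k : I) : 𝕜 := (L.eigenvalue k + m) • c k

theorem act_add_smul (c : I → 𝕜) : L.act c + m • c = L.shift m c := by
  ext k
  simp [act, shift, add_smul]

theorem eNorm_le_eNorm_add_two (d : ℝ) (c : I → 𝕜) : L.eNorm d c ≤ L.eNorm (d + 2) c := by
  have h := L.eNorm_le_mul_of_norm_le (d := d) (d' := d + 2) (K := 1) (a := c) (b := c)
    fun k => by
      have hk := L.eigenvalue_nonneg k
      rw [show (d - (d + 2)) / 2 = -1 by ring, Real.rpow_neg_one, NNReal.coe_one]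
      exact mul_le_mul_of_nonneg_right (inv_le_one_of_one_le₀ (by linarith)) (norm_nonneg _)
  simpa using h

theorem eNorm_shift_le (hm : 0 < m) (d : ℝ) (c : I → 𝕜) :
    L.eNorm d (L.shift m c) ≤ (max 1 m.toNNReal : ℝ≥0) * L.eNorm (d + 2) c := by
  refine L.eNorm_le_mul_of_norm_le fun k => ?_
  have hk := L.eigenvalue_nonneg k
  have hk1 := L.one_add_eigenvalue_pos k
  rw [show (d - (d + 2)) / 2 = -1 by ring, Real.rpow_neg_one, shift, norm_smul,
    Real.norm_of_nonneg (by linarith), ← mul_assoc]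
  refine mul_le_mul_of_nonneg_right ?_ (norm_nonneg _)
  rw [inv_mul_le_iff₀ hk1, NNReal.coe_max, NNReal.coe_one, Real.coe_toNNReal m hm.le]
  nlinarith [le_max_left 1 m, le_max_right 1 m]

/-- Positivity of `m` makes `λ + m` control `1 + λ` down to `λ = 0`, at the price of `max(1, 1/m)`.
-/
theorem eNorm_add_two_le (hm : 0 < m) (d : ℝ) (c : I → 𝕜) :
    L.eNorm (d + 2) c ≤ (max 1 m⁻¹.toNNReal : ℝ≥0) * L.eNorm d (L.shift m c) := by
  refine L.eNorm_le_mul_of_norm_le fun k => ?_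
  have hk := L.eigenvalue_nonneg k
  rw [show (d + 2 - d) / 2 = 1 by ring, Real.rpow_one, shift, norm_smul,
    Real.norm_of_nonneg (by linarith), ← mul_assoc]
  refine mul_le_mul_of_nonneg_right ?_ (norm_nonneg _)
  rw [NNReal.coe_max, NNReal.coe_one, Real.coe_toNNReal _ (inv_pos.2 hm).le, mul_add]
  have h1 := le_max_left 1 m⁻¹
  have h2 : 1 ≤ max 1 m⁻¹ * m := by
    calc 1 = m⁻¹ * m := (inv_mul_cancel₀ hm.ne').symm
      _ ≤ _ := by gcongr; exact le_max_right _ _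
  nlinarith

/-! ### A priori bounds -/

/-- The constant in the bound of the series solution in `𝓗^{d+2}`. -/
def solutionBound (q m T : ℝ) : ℝ≥0 :=
  4 * (1 + T.toNNReal + (max 1 m⁻¹.toNNReal) *
    (2 * (2 * Real.exp (1 / (1 - q)) / qPochInf q q).toNNReal * (1 - q)⁻¹.toNNReal *
      (4 * (1 + (max 1 m.toNNReal) + T.toNNReal * max 1 m.toNNReal))))

variable {φ ρ : I → 𝕜} {f : ℝ → I → 𝕜} {S : ℝ≥0∞}

theorem eNorm_source_le (hm : 0 < m) (hφ : L.eNorm (d + 2) φ ≤ S)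
    (hρ : L.eNorm (d + 2) ρ ≤ S) {s : ℝ} (hs : s ∈ Set.Ioc 0 T) (hf : L.eNorm d (f s) ≤ S) :
    L.eNorm d (f s - L.shift m φ - s • L.shift m ρ)
      ≤ (4 * (1 + (max 1 m.toNNReal) + T.toNNReal * max 1 m.toNNReal) : ℝ≥0) * S := by
  set K : ℝ≥0 := max 1 m.toNNReal
  have h1 : L.eNorm d (L.shift m φ) ≤ K * S := (L.eNorm_shift_le hm d φ).trans (by gcongr)
  have h2 : L.eNorm d (s • L.shift m ρ) ≤ T.toNNReal * (K * S) := by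
    rw [eNorm_smul, Real.enorm_of_nonneg hs.1.le]
    refine mul_le_mul' (ENNReal.ofReal_le_ofReal hs.2) ?_
    exact (L.eNorm_shift_le hm d ρ).trans (by gcongr)
  calc _ ≤ 2 * (L.eNorm d (f s - L.shift m φ) + L.eNorm d (s • L.shift m ρ)) :=
        L.eNorm_sub_le _ _ _
    _ ≤ 2 * (2 * (L.eNorm d (f s) + L.eNorm d (L.shift m φ)) + L.eNorm d (s • L.shift m ρ)) := by
        gcongr
        exact L.eNorm_sub_le _ _ _
    _ ≤ 2 * (2 * (S + K * S) + T.toNNReal * (K * S)) := by gcongr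
    _ ≤ 2 * (2 * (S + K * S) + T.toNNReal * (K * S)) + 2 * (T.toNNReal * (K * S)) := le_self_add
    _ = _ := by push_cast; ring

theorem exists_norm_apply_le_on (hS : S < ∞) {g : ℝ → I → 𝕜}
    (hg : ∀ s ∈ Set.Ioc 0 T, L.eNorm d (g s) ≤ S) (k : I) :
    ∃ M : ℝ, ∀ s ∈ Set.Ioc 0 T, ‖g s k‖ ≤ M := by
  obtain ⟨M, hM⟩ := L.exists_norm_apply_le d k hS
  exact ⟨M, fun s hs => hM _ (hg s hs)⟩

theorem seriesSolution_spec (hq0 : 0 < q) (hq1 : q < 1) (hα : 0 < α) (hm : 0 < m)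
    (hφ : L.eNorm (d + 2) φ ≤ S) (hρ : L.eNorm (d + 2) ρ ≤ S) (hS : S < ∞)
    (hf : ∀ s ∈ Set.Ioc 0 T, L.eNorm d (f s) ≤ S) {t : ℝ} (ht : t ∈ Set.Ioc 0 T) :
    (∀ k, JacksonIntegrable q t (L.duhamelIntegrand q α m f t k)) ∧
    L.eNorm (d + 2) (L.seriesSolution q α m φ ρ f t) ≤ solutionBound q m T * S ∧
    ∀ k, L.seriesSolution q α m φ ρ f t k = φ k + t • ρ k +
      fracOp q α (fun s => (f s - L.shift m (L.seriesSolution q α m φ ρ f s)) k) t := by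
  have hmem := mem_Ioc_mul_pow hq0 hq1 ht
  set g : ℝ → I → 𝕜 := fun s => f s - L.shift m φ - s • L.shift m ρ with hg
  set c : ℝ≥0 := 4 * (1 + (max 1 m.toNNReal) + T.toNNReal * max 1 m.toNNReal) with hc
  have hgS : ∀ s ∈ Set.Ioc 0 T, L.eNorm d (g s) ≤ c * S := fun s hs =>
    L.eNorm_source_le hm hφ hρ hs (hf s hs)
  have hμ : ∀ k, 0 < L.eigenvalue k + m := fun k => by linarith [L.eigenvalue_nonneg k]
  have hrep : ∀ s ∈ Set.Ioc 0 T, ∀ k, JacksonIntegrable q s (L.duhamelIntegrand q α m f s k) ∧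
      L.seriesSolution q α m φ ρ f s k = φ k + s • ρ k +
        resolventOp q α (L.eigenvalue k + m) (fun s => g s k) s := fun s hs k => by
    obtain ⟨M, hM⟩ := L.exists_norm_apply_le_on hS hf k
    exact L.seriesSolution_eq hq0 hq1 hα hm φ ρ f hs.1 k
      fun n => hM _ (mem_Ioc_mul_pow hq0 hq1 hs n)
  refine ⟨fun k => (hrep t ht k).1, ?_, fun k => ?_⟩
  · set v : I → 𝕜 := fun k => resolventOp q α (L.eigenvalue k + m) (fun s => g s k) t with hv
    have hu : L.seriesSolution q α m φ ρ f t = φ + t • ρ + v := funext fun k => (hrep t ht k).2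
    set A : ℝ≥0 := (2 * Real.exp (1 / (1 - q)) / qPochInf q q).toNNReal with hA
    have h1 : L.eNorm d (L.shift m v) ≤ 2 * A * (1 - q)⁻¹.toNNReal * (c * S) :=
      L.eNorm_le_of_enorm_le_tsum hq0 hq1 (g := fun j => g (t * q ^ j))
        (fun j => hgS _ (hmem j))
        fun k => norm_smul_resolventOp_le hq0 hq1 hα (hμ k).le ht.1 fun s => g s k
    have h2 : L.eNorm (d + 2) v ≤ (max 1 m⁻¹.toNNReal : ℝ≥0) *
        (2 * A * (1 - q)⁻¹.toNNReal * (c * S)) := (L.eNorm_add_two_le hm d v).trans (by gcongr)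
    have h3 : L.eNorm (d + 2) (t • ρ) ≤ T.toNNReal * S := by
      rw [eNorm_smul, Real.enorm_of_nonneg ht.1.le]
      exact mul_le_mul' (ENNReal.ofReal_le_ofReal ht.2) hρ
    rw [hu]
    calc _ ≤ 2 * (L.eNorm (d + 2) (φ + t • ρ) + L.eNorm (d + 2) v) := L.eNorm_add_le _ _ _
      _ ≤ 2 * (2 * (L.eNorm (d + 2) φ + L.eNorm (d + 2) (t • ρ)) + L.eNorm (d + 2) v) := by
          gcongr
          exact L.eNorm_add_le _ _ _
      _ ≤ 2 * (2 * (S + T.toNNReal * S) + (max 1 m⁻¹.toNNReal : ℝ≥0) *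
          (2 * A * (1 - q)⁻¹.toNNReal * (c * S))) := by gcongr
      -- Slack that lets one factor 4 serve every summand of `solutionBound`.
      _ ≤ 2 * (2 * (S + T.toNNReal * S) + (max 1 m⁻¹.toNNReal : ℝ≥0) *
          (2 * A * (1 - q)⁻¹.toNNReal * (c * S))) + 2 * ((max 1 m⁻¹.toNNReal : ℝ≥0) *
          (2 * A * (1 - q)⁻¹.toNNReal * (c * S))) := le_self_add
      _ = _ := by
          rw [solutionBound, ← hA, ← hc]
          push_cast
          ring
  · obtain ⟨M, hM⟩ := L.exists_norm_apply_le_on (ENNReal.mul_lt_top ENNReal.coe_lt_top hS) hgS k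
    -- Subtracting `μ` times the resolvent term from the source `f - μφ - sμρ` leaves `f - μu`.
    rw [(hrep t ht k).2, resolventOp_volterra hq0 hq1 hα (hμ k) hM ht]
    congr 1
    refine fracOp_congr fun j => ?_
    simp only [Pi.sub_apply, shift]
    rw [(hrep _ (hmem j) k).2]
    simp only [hg, Pi.sub_apply, Pi.smul_apply, shift]
    module

/-! ### Uniqueness -/

theorem IsGeneralisedSolution.volterra {L : PositiveOperator 𝕜 H I} (hq0 : 0 < q) (hq1 : q < 1)
    (hα1 : 1 < α) (hα2 : α < 2) {v : ℝ → I → 𝕜}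
    (hv : L.IsGeneralisedSolution q α m d T φ ρ f v) {t : ℝ} (ht : t ∈ Set.Ioc 0 T) (k : I) :
    v t k = φ k + t • ρ k + fracOp q α (fun s => (f s - L.shift m (v s)) k) t := by
  have hmem := mem_Ioc_mul_pow hq0 hq1 ht
  have hsum := fun {s : ℝ} (hs : s ∈ Set.Ioc 0 T) => hv.memW.1.summable hq0 hq1 hα1 hα2 hs
  have hρ := L.tendsto_apply_of_eNorm (hv.initial_deriv t ht) k
  rw [← hv.initial]
  refine eq_add_fracOp_of_caputo (v := fun s => v s k) hq0 hq1 hα2 ht.1 (hsum ht k) hρ fun n => ?_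
  rw [← caputo_apply hq0 hq1 hα1 hα2 (hmem n).1 (hsum (hmem n)), ← hv.equation _ (hmem n),
    add_assoc, act_add_smul]
  simp

theorem IsGeneralisedSolution.unique {L : PositiveOperator 𝕜 H I} (hq0 : 0 < q) (hq1 : q < 1)
    (hα1 : 1 < α) (hα2 : α < 2) (hm : 0 < m) (hS : S < ∞)
    (hf : ∀ s ∈ Set.Ioc 0 T, L.eNorm d (f s) ≤ S) {u v : ℝ → I → 𝕜}
    (hu : L.IsGeneralisedSolution q α m d T φ ρ f u)
    (hv : L.IsGeneralisedSolution q α m d T φ ρ f v) {t : ℝ} (ht : t ∈ Set.Icc 0 T) :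
    v t = u t := by
  rcases ht.1.eq_or_lt with rfl | ht0
  · rw [hu.initial, hv.initial]
  ext k
  have hbd : ∀ {w : ℝ → I → 𝕜}, L.IsGeneralisedSolution q α m d T φ ρ f w →
      ∃ M : ℝ, ∀ s ∈ Set.Ioc 0 T, ‖w s k‖ ≤ M := fun {w} hw =>
    L.exists_norm_apply_le_on (d := d + 2) (g := w)
      (S := ⨆ t ∈ Set.Icc 0 T, L.eNorm (d + 2) (w t)) hw.memLinfty
      (fun s hs => le_iSup₂ (f := fun s (_ : s ∈ Set.Icc 0 T) => L.eNorm (d + 2) (w s)) s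
        (Set.Ioc_subset_Icc_self hs)) k
  obtain ⟨Mf, hMf⟩ := L.exists_norm_apply_le_on hS hf k
  obtain ⟨Mu, hMu⟩ := hbd hu
  obtain ⟨Mv, hMv⟩ := hbd hv
  exact volterra_unique (μ := L.eigenvalue k + m) (x := fun s => φ k + s • ρ k)
    (F := fun s => f s k) (u := fun s => u s k) (v := fun s => v s k) hq0 hq1 (by linarith)
    (by linarith [L.eigenvalue_nonneg k]) hMf hMu hMv
    (fun s hs => hu.volterra hq0 hq1 hα1 hα2 hs k)
    (fun s hs => hv.volterra hq0 hq1 hα1 hα2 hs k) ⟨ht0, ht.2⟩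

end PositiveOperator

end

/-! ### The theorem -/

theorem theorem4p2 (q α m T : ℝ) (hq0 : 0 < q) (hq1 : q < 1) (hα1 : 1 < α) (hα2 : α < 2)
    (hm : 0 < m) (hT : 0 < T) :
    ∃ C : ℝ≥0, ∀ (𝕜 : Type*) (H : Type*) (I : Type*) [RCLike 𝕜] [NormedAddCommGroup H]
      [InnerProductSpace 𝕜 H] [CompleteSpace H] [Countable I] (L : PositiveOperator 𝕜 H I)
      (d : ℝ) (φ ρ : I → 𝕜) (f : ℝ → I → 𝕜),
      L.eNorm (d + 2) φ < ∞ → L.eNorm (d + 2) ρ < ∞ → L.MemC q 1 d T f →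
      ∃ u : ℝ → I → 𝕜,
        L.IsGeneralisedSolution q α m d T φ ρ f u ∧
        (∀ v : ℝ → I → 𝕜, L.IsGeneralisedSolution q α m d T φ ρ f v →
          ∀ t ∈ Set.Icc 0 T, v t = u t) ∧
        (∀ t ∈ Set.Icc 0 T,
          (∀ k, JacksonIntegrable q t (L.duhamelIntegrand q α m f t k)) ∧
          u t = L.seriesSolution q α m φ ρ f t) ∧
        (∀ t ∈ Set.Icc 0 T,
          L.eNorm d (caputo q α u t) ^ 2 + L.eNorm (d + 2) (u t) ^ 2 ≤
            C * (L.eNorm (d + 2) φ ^ 2 + L.eNorm (d + 2) ρ ^ 2 + L.eNormC q 1 d T f ^ 2)) := by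
  -- The summand 1 covers `t = 0`, where `u = φ`. The constant `K'` bounds `f - (𝓛 + m) u`, which is
  -- the Caputo derivative for `t > 0`; the factor 16 comes from squaring a sum of three norms.
  set K : ℝ≥0 := 1 + PositiveOperator.solutionBound q m T with hK
  set K' : ℝ≥0 := 2 * (1 + max 1 m.toNNReal * K) with hK'
  refine ⟨16 * (K' ^ 2 + K ^ 2), ?_⟩
  intro 𝕜 H I _ _ _ _ _ L d φ ρ f hφ hρ hf
  have hα : 0 < α := by linarith
  set F := L.eNormC q 1 d T f with hF
  set S := L.eNorm (d + 2) φ + L.eNorm (d + 2) ρ + F with hS'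
  have hS : S < ∞ := ENNReal.add_lt_top.2 ⟨ENNReal.add_lt_top.2 ⟨hφ, hρ⟩, hf.2⟩
  have hφS : L.eNorm (d + 2) φ ≤ S := le_self_add.trans le_self_add
  have hρS : L.eNorm (d + 2) ρ ≤ S := le_add_self.trans le_self_add
  have hfS : ∀ s ∈ Set.Ioc 0 T, L.eNorm d (f s) ≤ S := fun s hs => by
    refine le_trans ?_ (le_add_self : F ≤ S)
    rw [hF, PositiveOperator.eNormC, Finset.sum_range_succ, Finset.sum_range_one]
    refine le_trans ?_ le_self_add
    exact le_iSup₂ (f := fun s (_ : s ∈ Set.Ioc 0 T) => L.eNorm d (f s)) s hs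
  have hspec := fun {t : ℝ} (ht : t ∈ Set.Ioc 0 T) =>
    L.seriesSolution_spec hq0 hq1 hα hm hφS hρS hS hfS ht
  set u := L.seriesSolution q α m φ ρ f with hu
  have hu0 : u 0 = φ := L.seriesSolution_zero hq0 hq1 hα φ ρ f
  have huS : ∀ t ∈ Set.Icc 0 T, L.eNorm (d + 2) (u t) ≤ K * S := by
    intro t ht
    have hK1 : (K : ℝ≥0∞) * S = S + PositiveOperator.solutionBound q m T * S := by
      rw [hK]; push_cast; ring
    rw [hK1]
    rcases ht.1.eq_or_lt with rfl | ht0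
    · rw [hu0]
      exact hφS.trans le_self_add
    · exact (hspec ⟨ht0, ht.2⟩).2.1.trans le_add_self
  have hGS : ∀ s ∈ Set.Ioc 0 T, L.eNorm d (f s - L.shift m (u s)) ≤ K' * S := by
    intro s hs
    calc _ ≤ 2 * (L.eNorm d (f s) + L.eNorm d (L.shift m (u s))) := L.eNorm_sub_le _ _ _
      _ ≤ 2 * (S + (max 1 m.toNNReal : ℝ≥0) * (K * S)) := by
          gcongr
          · exact hfS s hs
          · exact (L.eNorm_shift_le hm d _).trans
              (mul_le_mul_right (huS s (Set.Ioc_subset_Icc_self hs)) _)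
      _ = _ := by rw [hK']; push_cast; ring
  obtain ⟨hcap, hcapG, hder⟩ := L.caputo_of_volterra hq0 hq1 hα1 hα2
    (ENNReal.mul_lt_top ENNReal.coe_lt_top hS) hGS fun t ht => (hspec ht).2.2
  have hcapS : ∀ t ∈ Set.Icc 0 T, L.eNorm d (caputo q α u t) ≤ K' * S := by
    intro t ht
    rcases ht.1.eq_or_lt with rfl | ht0
    · rw [caputo_zero_right]
      have : L.eNorm d (0 : I → 𝕜) = 0 := by
        have h := L.eNorm_smul d 0 (0 : I → 𝕜)
        rwa [zero_smul, enorm_zero, zero_mul] at h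
      rw [this]
      exact zero_le
    · rw [hcapG t ⟨ht0, ht.2⟩]
      exact hGS t ⟨ht0, ht.2⟩
  have hKS : (K : ℝ≥0∞) * S < ∞ := ENNReal.mul_lt_top ENNReal.coe_lt_top hS
  have hKS' : (K' : ℝ≥0∞) * S < ∞ := ENNReal.mul_lt_top ENNReal.coe_lt_top hS
  have hsol : L.IsGeneralisedSolution q α m d T φ ρ f u :=
    { memLinfty := (iSup₂_le huS).trans_lt hKS
      memW := ⟨hcap, ENNReal.add_lt_top.2
        ⟨(iSup₂_le fun t ht => (L.eNorm_le_eNorm_add_two d _).trans (huS t ht)).trans_lt hKS,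
          (iSup₂_le hcapS).trans_lt hKS'⟩⟩
      equation := fun t ht => by
        rw [hcapG t ht, add_assoc, L.act_add_smul, sub_add_cancel]
      initial := hu0
      initial_deriv := hder hu0 }
  refine ⟨u, hsol, fun v hv t ht => hsol.unique hq0 hq1 hα1 hα2 hm hS hfS hv ht,
    fun t ht => ⟨fun k => ?_, rfl⟩, fun t ht => ?_⟩
  · rcases ht.1.eq_or_lt with rfl | ht0
    · exact PositiveOperator.jacksonIntegrable_zero hq0 hq1 _
    · exact (hspec ⟨ht0, ht.2⟩).1 k
  · have hSsq : S ^ 2 ≤ 16 * (L.eNorm (d + 2) φ ^ 2 + L.eNorm (d + 2) ρ ^ 2 + F ^ 2) := by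
      calc S ^ 2 ≤ 4 * ((L.eNorm (d + 2) φ + L.eNorm (d + 2) ρ) ^ 2 + F ^ 2) :=
            ENNReal.add_sq_le_four_mul _ _
        _ ≤ 4 * (4 * (L.eNorm (d + 2) φ ^ 2 + L.eNorm (d + 2) ρ ^ 2) + 4 * F ^ 2) := by
            gcongr
            · exact ENNReal.add_sq_le_four_mul _ _
            · exact le_mul_of_one_le_left' (by norm_num)
        _ = _ := by ring
    calc _ ≤ ((K' : ℝ≥0∞) * S) ^ 2 + (K * S) ^ 2 := by
          gcongr
          · exact hcapS t ht
          · exact huS t ht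
      _ = ((K' : ℝ≥0∞) ^ 2 + K ^ 2) * S ^ 2 := by ring
      _ ≤ ((K' : ℝ≥0∞) ^ 2 + K ^ 2) *
          (16 * (L.eNorm (d + 2) φ ^ 2 + L.eNorm (d + 2) ρ ^ 2 + F ^ 2)) := by gcongr
      _ = _ := by push_cast; ring
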